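/- Let $L>0$ and let $\bar\rho,\bar\theta,R,c_v,\kappa>0$, $\mu>0$ and $\lambda$ with $\lambda+\mu\ge 0$ be real constants. For $T>0$ and $g,h\in L^2(0,T;L^2(0,L))$ consider the system \begin{align*} &\rho_t+\bar\rho\,u_x=0 &&\text{in }(0,L)\times(0,T),\\ &u_t-\frac{\lambda+2\mu}{\bar\rho}u_{xx}+\frac{R\bar\theta}{\bar\rho}\rho_x+R\theta_x=g &&\text{in }(0,L)\times(0,T),\\ &\theta_t-\frac{\kappa}{\bar\rho c_v}\theta_{xx}+\frac{R\bar\theta}{c_v}u_x=h &&\text{in }(0,L)\times(0,T),\\ &u(0,t)=u(L,t)=\theta(0,t)=\theta(L,t)=0, &&t\in(0,T),\\ &\rho(0)=\rho_0,\quad u(0)=u_0,\quad \theta(0)=\theta_0 &&\text{in }(0,L). \end{align*} A solution is a triple $(\rho,u,\theta)\in C([0,T];L^2(0,L)^3)$ with $u,\theta\in L^2(0,T;H^1_0(0,L))$ that satisfies, for all $t\in[0,T]$, the equations integrated over $(0,t)$ with the given initial values: the first one in $L^2(0,L)$, the other two tested against every $\varphi\in H^1_0(0,L)$, where $-u_{xx}$,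 $-\theta_{xx}$ and $\rho_x$ are paired with $\varphi$ as $\int_0^L u_x\varphi_x\,dx$, $\int_0^L\theta_x\varphi_x\,dx$ and $-\int_0^L\rho\,\varphi_x\,dx$. Let $H^1_m(0,L)=\{\rho\in H^1(0,L):\int_0^L\rho\,dx=0\}$ and let $(\rho_0,u_0,\theta_0)\in H^1_m(0,L)\times L^2(0,L)\times L^2(0,L)$. Then for every $T>0$ there exist controls $g,h\in L^2(0,T;L^2(0,L))$ such that the system has a unique solution $(\rho,u,\theta)$, and this solution satisfies $(\rho,u,\theta)(\cdot,T)=(0,0,0)$ in $L^2(0,L)^3$. -/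

import Mathlib

open scoped ContDiff

namespace LinNS

open MeasureTheory Set

noncomputable section

/-- The real Hilbert space `L²(0,L)`. -/
abbrev L2 (L : ℝ) : Type := Lp ℝ 2 (volume.restrict (Ioo (0 : ℝ) L))

/-- `g ∈ L²(0,T; L²(0,L))` (Bochner sense). -/
def MemL2L2 (L T : ℝ) (g : ℝ → L2 L) : Prop :=
  MemLp g 2 (volume.restrict (Ioo (0 : ℝ) T))

/-- `φ ∈ C_c^∞(0,L)`. -/
def IsTestFun (L : ℝ) (φ : ℝ → ℝ) : Prop :=
  ContDiff ℝ ∞ φ ∧ HasCompactSupport φ ∧ tsupport φ ⊆ Ioo 0 L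

/-- `f'` is the weak derivative of `f` on `(0,L)`. -/
def HasWeakDeriv (L : ℝ) (f f' : L2 L) : Prop :=
  ∀ φ : ℝ → ℝ, IsTestFun L φ →
    ∫ x in Ioo 0 L, f x * deriv φ x = -∫ x in Ioo 0 L, f' x * φ x

/-- `H¹_m(0,L)`: the functions of `H¹(0,L)` with zero mean. -/
def H1m (L : ℝ) : Set (L2 L) :=
  {f | (∃ f' : L2 L, HasWeakDeriv L f f') ∧ ∫ x in Ioo 0 L, f x = 0}

/-- The pairs `(φ, φ')` with `φ ∈ C_c^∞(0,L)`, as elements of `L² × L²`. -/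
def testGraph (L : ℝ) : Set (L2 L × L2 L) :=
  {p | ∃ φ : ℝ → ℝ, IsTestFun L φ ∧
    (∀ᵐ x ∂(volume.restrict (Ioo 0 L)), p.1 x = φ x) ∧
    (∀ᵐ x ∂(volume.restrict (Ioo 0 L)), p.2 x = deriv φ x)}

/-- `H¹₀(0,L)`, the closure of `C_c^∞(0,L)` for the `H¹` norm, each element `v` being
listed together with its derivative as the pair `(v, v_x)`. -/
def H10Graph (L : ℝ) : Set (L2 L × L2 L) := closure (testGraph L)

/-- `u ∈ L²(0,T; H¹₀(0,L))`, with space derivative `ux`. -/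
def MemL2H10 (L T : ℝ) (u ux : ℝ → L2 L) : Prop :=
  MemL2L2 L T u ∧ MemL2L2 L T ux ∧
    ∀ᵐ t ∂(volume.restrict (Ioo (0 : ℝ) T)), (u t, ux t) ∈ H10Graph L

/-- The physical constants: the steady state `(ρ̄, 0, θ̄)`, the viscosities `lam`, `mu`, the heat
conductivity `kappa`, the specific heat `cv` and the gas constant `R`. -/
structure Fluid where
  rhoBar : ℝ
  thetaBar : ℝ
  lam : ℝ
  mu : ℝ
  kappa : ℝ
  cv : ℝ
  R : ℝ
  rhoBar_pos : 0 < rhoBar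
  thetaBar_pos : 0 < thetaBar
  mu_pos : 0 < mu
  lam_add_mu_nonneg : 0 ≤ lam + mu
  kappa_pos : 0 < kappa
  cv_pos : 0 < cv
  R_pos : 0 < R

/-- `(ρ, u, θ)` is a (weak) solution on `(0,L) × (0,T)` of

* `ρ_t + ρ̄ u_x = f`,
* `u_t - ((λ+2μ)/ρ̄) u_xx + (R θ̄/ρ̄) ρ_x + R θ_x = g`,
* `θ_t - (κ/(ρ̄ c_v)) θ_xx + (R θ̄/c_v) u_x = h`,

with `u = θ = 0` at `x = 0, L` and initial values `ρ₀, u₀, θ₀`: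
`ρ, u, θ ∈ C([0,T]; L²(0,L))`, `u, θ ∈ L²(0,T; H¹₀(0,L))`, and the equations, integrated from
time `0` to `t`, hold for all `t ∈ [0,T]`: the first in `L²(0,L)`, the other two tested against
every `φ ∈ H¹₀(0,L)`. -/
def IsSolution (F : Fluid) (L T : ℝ) (ρ₀ u₀ θ₀ : L2 L) (f g h : ℝ → L2 L)
    (ρ u θ : ℝ → L2 L) : Prop :=
  ContinuousOn ρ (Icc 0 T) ∧ ContinuousOn u (Icc 0 T) ∧ ContinuousOn θ (Icc 0 T) ∧
  ∃ ux θx : ℝ → L2 L, MemL2H10 L T u ux ∧ MemL2H10 L T θ θx ∧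
    ∀ t ∈ Icc 0 T,
      (ρ t - ρ₀ + F.rhoBar • ∫ s in (0 : ℝ)..t, ux s) = ∫ s in (0 : ℝ)..t, f s ∧
      ∀ φ φx : L2 L, (φ, φx) ∈ H10Graph L →
        (inner ℝ (u t) φ - inner ℝ u₀ φ
          + (F.lam + 2 * F.mu) / F.rhoBar * (∫ s in (0 : ℝ)..t, inner ℝ (ux s) φx)
          - F.R * F.thetaBar / F.rhoBar * (∫ s in (0 : ℝ)..t, inner ℝ (ρ s) φx)
          + F.R * (∫ s in (0 : ℝ)..t, inner ℝ (θx s) φ)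
          = ∫ s in (0 : ℝ)..t, inner ℝ (g s) φ) ∧
        (inner ℝ (θ t) φ - inner ℝ θ₀ φ
          + F.kappa / (F.rhoBar * F.cv) * (∫ s in (0 : ℝ)..t, inner ℝ (θx s) φx)
          + F.R * F.thetaBar / F.cv * (∫ s in (0 : ℝ)..t, inner ℝ (ux s) φ)
          = ∫ s in (0 : ℝ)..t, inner ℝ (h s) φ)

end

end LinNS

namespace LinNS

open MeasureTheory Set Filter Topology

/-! Since `g` and `h` act on the whole interval, `u` and `θ` may be prescribed and the controls read
off from the equations; the only demand is that the resulting `g` and `h` be square integrable. The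
density has no control of its own: it ends at `ρ₀ - ρ̄ ∫₀ᵀ u_x`, so the trajectory of `u` must
satisfy `∫₀ᵀ u = ρ̄⁻¹ ∫₀ˣ ρ₀`. The right-hand side lies in `H¹₀` exactly because `ρ₀` has zero mean
(`primitive_mem_H10`).

The data `u₀`, `θ₀` are only in `L²`, so the trajectories start with the Dirichlet heat flow `Z`.
The product `w = (1 - t/T) Z` vanishes at time `T` and solves the heat equation with source `-Z/T`,
which is continuous in time with values in `L²` (`exists_heat_flow_to_zero`). For `θ` this suffices.
For `u` one adds `η(t) Q`, where `η` vanishes at `0` and `T` and has integral one, and `Q = ρ̄⁻¹ ∫₀ˣ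
ρ₀ - ∫₀ᵀ w`. The control then contains `Q_xx` and `ρ_x`. Both are in `L²`, because `ρ₀` is in `H¹`
and because the heat equation integrated in time expresses the second space derivative of `∫₀ᵗ w` by
`w(t)`, `u₀` and the integrated source (`exists_controlled_solution`).

Uniqueness comes from an energy estimate for the time primitives of a difference of two solutions:
these are admissible test functions at every time, and Young's inequality with Gronwall's lemma
closes the estimate (`homogeneous_eq_zero`). -/

/-! ### The space `H¹₀`, weak derivatives, density of test functions -/

/-- The graph of the derivative on `C_c^∞(0,L)`, as a subspace of `L² × L²`. -/
def testSubmodule (L : ℝ) : Submodule ℝ (L2 L × L2 L) where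
  carrier := testGraph L
  zero_mem' := by
    refine ⟨fun _ => 0, ⟨contDiff_const, HasCompactSupport.zero, ?_⟩, ?_, ?_⟩
    · simp [tsupport, Function.support_fun_zero]
    · exact Lp.coeFn_zero _ _ _
    · filter_upwards [Lp.coeFn_zero ℝ 2 (volume.restrict (Ioo (0 : ℝ) L))] with x hx
      simpa using hx
  add_mem' := by
    rintro p q ⟨φ, ⟨hφ, hφc, hφs⟩, h1, h2⟩ ⟨ψ, ⟨hψ, hψc, hψs⟩, h3, h4⟩
    refine ⟨φ + ψ, ⟨hφ.add hψ, hφc.add hψc,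
      (tsupport_add φ ψ).trans (union_subset hφs hψs)⟩, ?_, ?_⟩
    · filter_upwards [h1, h3, Lp.coeFn_add p.1 q.1] with x a b c
      simp only [Prod.fst_add, c, Pi.add_apply, a, b]
    · filter_upwards [h2, h4, Lp.coeFn_add p.2 q.2] with x a b c
      rw [deriv_add ((hφ.differentiable (by simp)) x) ((hψ.differentiable (by simp)) x)]
      simp only [Prod.snd_add, c, Pi.add_apply, a, b]
  smul_mem' := by
    rintro r p ⟨φ, ⟨hφ, hφc, hφs⟩, h1, h2⟩
    refine ⟨r • φ, ⟨hφ.const_smul r, hφc.smul_left (f := fun _ => r),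
      (tsupport_smul_subset_right (fun _ => r) φ).trans hφs⟩, ?_, ?_⟩
    · filter_upwards [h1, Lp.coeFn_smul r p.1] with x a c
      simp only [Prod.smul_fst, c, Pi.smul_apply, a]
    · filter_upwards [h2, Lp.coeFn_smul r p.2] with x a c
      rw [deriv_const_smul r ((hφ.differentiable (by simp)) x)]
      simp only [Prod.smul_snd, c, Pi.smul_apply, a]

/-- `H¹₀(0,L)` as a closed subspace of `L² × L²`. -/
noncomputable def H10 (L : ℝ) : Submodule ℝ (L2 L × L2 L) := (testSubmodule L).topologicalClosure

theorem mem_H10 {L : ℝ} {p : L2 L × L2 L} : p ∈ H10 L ↔ p ∈ H10Graph L := Iff.rfl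

theorem isClosed_H10 (L : ℝ) : IsClosed (H10 L : Set (L2 L × L2 L)) :=
  Submodule.isClosed_topologicalClosure _

theorem inner_eq_integral {L : ℝ} (f g : L2 L) : inner ℝ f g = ∫ x in Ioo 0 L, f x * g x := by
  rw [L2.inner_def]
  simp [mul_comm]

/-- The definition of the weak derivative extends from test functions to `H¹₀`. -/
theorem HasWeakDeriv.inner_eq {L : ℝ} {f f' φ φx : L2 L} (hf : HasWeakDeriv L f f')
    (hφ : (φ, φx) ∈ H10 L) : inner ℝ f φx = -inner ℝ f' φ := by
  have hcl : IsClosed {p : L2 L × L2 L | inner ℝ f p.2 = -inner ℝ f' p.1} :=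
    isClosed_eq (by fun_prop) (by fun_prop)
  refine closure_minimal ?_ hcl (mem_H10.1 hφ)
  rintro ⟨p, q⟩ ⟨ψ, hψ, h1, h2⟩
  simp only [mem_ofPred_eq, inner_eq_integral]
  have e1 : ∫ x in Ioo 0 L, f x * q x = ∫ x in Ioo 0 L, f x * deriv ψ x :=
    integral_congr_ae (by filter_upwards [h2] with x hx; rw [hx])
  have e2 : ∫ x in Ioo 0 L, f' x * p x = ∫ x in Ioo 0 L, f' x * ψ x :=
    integral_congr_ae (by filter_upwards [h1] with x hx; rw [hx])
  rw [e1, e2, hf ψ hψ]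

theorem IsTestFun.memLp {L : ℝ} {φ : ℝ → ℝ} (hφ : IsTestFun L φ) :
    MemLp φ 2 (volume.restrict (Ioo (0 : ℝ) L)) :=
  (hφ.1.continuous.memLp_of_hasCompactSupport hφ.2.1).restrict _

/-- Test functions are dense in `L²(0,L)`. -/
theorem dense_testFun (L : ℝ) :
    Dense {f : L2 L | ∃ φ, IsTestFun L φ ∧ f =ᵐ[volume.restrict (Ioo 0 L)] φ} := by
  let S : Submodule ℝ (L2 L) := (testSubmodule L).map (LinearMap.fst ℝ _ _)
  have hS : (S : Set (L2 L)) ⊆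
      {f : L2 L | ∃ φ, IsTestFun L φ ∧ f =ᵐ[volume.restrict (Ioo 0 L)] φ} := by
    rintro _ ⟨p, ⟨φ, hφ, h1, h2⟩, rfl⟩
    exact ⟨φ, hφ, h1⟩
  refine Dense.mono hS ?_
  rw [Submodule.dense_iff_topologicalClosure_eq_top, Submodule.topologicalClosure_eq_top_iff,
    Submodule.eq_bot_iff]
  intro f hf
  rw [Lp.eq_zero_iff_ae_eq_zero]
  have hloc : LocallyIntegrableOn f (Ioo 0 L) volume :=
    (show IntegrableOn f (Ioo 0 L) volume from
      (Lp.memLp f).integrable (by norm_num)).locallyIntegrableOn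
  -- Fundamental lemma of the calculus of variations: an `L²` function orthogonal to all test
  -- functions vanishes almost everywhere.
  have := isOpen_Ioo.ae_eq_zero_of_integral_contDiff_smul_eq_zero hloc (fun g hg hgc hgs => ?_)
  · exact (ae_restrict_iff' measurableSet_Ioo).2 this
  · have hgt : IsTestFun L g := ⟨hg, hgc, hgs⟩
    have hdt : MemLp (deriv g) 2 (volume.restrict (Ioo (0 : ℝ) L)) :=
      ((hg.continuous_deriv (by simp)).memLp_of_hasCompactSupport hgc.deriv).restrict _
    have hm : hgt.memLp.toLp g ∈ S :=
      ⟨(hgt.memLp.toLp g, hdt.toLp _), ⟨g, hgt, hgt.memLp.coeFn_toLp, hdt.coeFn_toLp⟩, rfl⟩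
    have h0 := (Submodule.mem_orthogonal _ _).1 hf _ hm
    rw [inner_eq_integral] at h0
    have e : ∫ x in Ioo 0 L, g x • f x = ∫ x in Ioo 0 L, (hgt.memLp.toLp g) x * f x :=
      integral_congr_ae (by
        filter_upwards [hgt.memLp.coeFn_toLp] with x hx
        rw [hx, smul_eq_mul])
    refine Eq.trans (Eq.symm ?_) (e.trans h0)
    refine setIntegral_eq_integral_of_forall_compl_eq_zero (fun x hx => ?_)
    rw [image_eq_zero_of_notMem_tsupport (fun h => hx (hgs h)), zero_smul]

/-! ### The primitive vanishing at `0` -/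

theorem integrableOn_L2 {L : ℝ} (w : L2 L) : IntegrableOn w (Ioo 0 L) volume :=
  (Lp.memLp w).integrable (by norm_num)

theorem intervalIntegrable_L2 {L : ℝ} (w : L2 L) {a b : ℝ} (ha : a ∈ Icc 0 L) (hb : b ∈ Icc 0 L) :
    IntervalIntegrable w volume a b := by
  rw [intervalIntegrable_iff]
  refine IntegrableOn.mono_set ((integrableOn_Icc_iff_integrableOn_Ioo).2 (integrableOn_L2 w)) ?_
  rw [uIoc]
  exact Ioc_subset_Icc_self.trans (Icc_subset_Icc (le_min ha.1 hb.1) (max_le ha.2 hb.2))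

/-- Cauchy–Schwarz against the indicator of `(0,x)`, whose norm is `x^(1/2)`. -/
theorem abs_primitive_le {L : ℝ} (w : L2 L) {x : ℝ} (hx : x ∈ Icc 0 L) :
    |∫ y in (0 : ℝ)..x, w y| ≤ L ^ (1 / 2 : ℝ) * ‖w‖ := by
  have hsub : Ioo 0 x ⊆ Ioo 0 L := Ioo_subset_Ioo_right hx.2
  have e : ∫ y in (0 : ℝ)..x, w y
      = ∫ y in Ioo 0 x, w y ∂(volume.restrict (Ioo 0 L)) := by
    rw [intervalIntegral.integral_of_le hx.1, integral_Ioc_eq_integral_Ioo,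
      Measure.restrict_restrict measurableSet_Ioo, inter_eq_left.2 hsub]
  rw [e, ← L2.inner_indicatorConstLp_one measurableSet_Ioo (measure_ne_top _ _) w]
  refine (abs_real_inner_le_norm _ _).trans ?_
  gcongr
  rw [norm_indicatorConstLp (by norm_num) (by norm_num)]
  simp only [norm_one, one_mul]
  have : (volume.restrict (Ioo 0 L)).real (Ioo 0 x) = x := by
    rw [measureReal_restrict_apply measurableSet_Ioo, inter_eq_left.2 hsub]
    simp [hx.1]
  rw [this]
  have := hx.1
  have h2 := hx.2
  norm_num
  gcongr

theorem continuousOn_primitive_L2 {L : ℝ} (hL : 0 < L) (w : L2 L) :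
    ContinuousOn (fun x => ∫ y in (0 : ℝ)..x, w y) (Icc 0 L) := by
  have := intervalIntegral.continuousOn_primitive_interval (a := 0) (b := L) (f := w)
    (μ := volume) (by
      rw [uIcc_of_le hL.le]; exact (integrableOn_Icc_iff_integrableOn_Ioo).2 (integrableOn_L2 w))
  rwa [uIcc_of_le hL.le] at this

theorem memLp_primitive {L : ℝ} (hL : 0 < L) (w : L2 L) :
    MemLp (fun x => ∫ y in (0 : ℝ)..x, w y) 2 (volume.restrict (Ioo (0 : ℝ) L)) := by
  refine MemLp.of_bound (((continuousOn_primitive_L2 hL w).mono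
    Ioo_subset_Icc_self).aestronglyMeasurable measurableSet_Ioo) (L ^ (1 / 2 : ℝ) * ‖w‖) ?_
  filter_upwards [ae_restrict_mem measurableSet_Ioo] with x hx
  exact abs_primitive_le w (Ioo_subset_Icc_self hx)

/-- The operator `w ↦ ∫₀ˣ w` on `L²(0,L)`. -/
noncomputable def primitive {L : ℝ} (hL : 0 < L) : L2 L →L[ℝ] L2 L :=
  LinearMap.mkContinuous
    { toFun := fun w => (memLp_primitive hL w).toLp _
      map_add' := fun v w => by
        rw [← MemLp.toLp_add]
        refine MemLp.toLp_congr _ _ ?_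
        filter_upwards [ae_restrict_mem measurableSet_Ioo] with x hx
        have hx' := Ioo_subset_Icc_self hx
        have h0 : (0 : ℝ) ∈ Icc 0 L := ⟨le_rfl, hL.le⟩
        simp only [Pi.add_apply]
        rw [← intervalIntegral.integral_add (intervalIntegrable_L2 v h0 hx')
          (intervalIntegrable_L2 w h0 hx')]
        refine intervalIntegral.integral_congr_ae ?_
        have := (ae_restrict_iff' measurableSet_Ioo).1 (Lp.coeFn_add v w)
        filter_upwards [this] with y hy hy'
        rw [uIoc_of_le hx.1.le] at hy'
        exact hy ⟨hy'.1, hy'.2.trans_lt hx.2⟩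
      map_smul' := fun c w => by
        rw [RingHom.id_apply, ← MemLp.toLp_const_smul]
        refine MemLp.toLp_congr _ _ ?_
        filter_upwards [ae_restrict_mem measurableSet_Ioo] with x hx
        simp only [Pi.smul_apply]
        rw [← intervalIntegral.integral_smul]
        refine intervalIntegral.integral_congr_ae ?_
        have := (ae_restrict_iff' measurableSet_Ioo).1 (Lp.coeFn_smul c w)
        filter_upwards [this] with y hy hy'
        rw [uIoc_of_le hx.1.le] at hy'
        exact hy ⟨hy'.1, hy'.2.trans_lt hx.2⟩ }
    ((volume.restrict (Ioo (0 : ℝ) L)).real univ ^ (2 : ENNReal).toReal⁻¹ * L ^ (1 / 2 : ℝ))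
    (fun w => by
      rw [mul_assoc]
      refine Lp.norm_le_of_ae_bound (by positivity) ?_
      filter_upwards [(memLp_primitive hL w).coeFn_toLp,
        ae_restrict_mem measurableSet_Ioo] with x hx hx'
      simp only [LinearMap.coe_mk, AddHom.coe_mk]
      rw [hx]
      exact abs_primitive_le w (Ioo_subset_Icc_self hx'))

theorem coeFn_primitive {L : ℝ} (hL : 0 < L) (w : L2 L) :
    primitive hL w =ᵐ[volume.restrict (Ioo 0 L)] fun x => ∫ y in (0 : ℝ)..x, w y :=
  (memLp_primitive hL w).coeFn_toLp

theorem IsTestFun.sub_smul {L : ℝ} {φ χ : ℝ → ℝ} (hφ : IsTestFun L φ) (hχ : IsTestFun L χ)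
    (c : ℝ) : IsTestFun L (fun x => φ x - c * χ x) := by
  have h : tsupport (fun x => φ x - c * χ x) ⊆ tsupport φ ∪ tsupport χ := by
    refine closure_minimal (fun x hx => ?_) ((isClosed_tsupport _).union (isClosed_tsupport _))
    by_contra hn
    rw [mem_union, not_or] at hn
    exact hx (by simp [image_eq_zero_of_notMem_tsupport hn.1, image_eq_zero_of_notMem_tsupport hn.2])
  refine ⟨hφ.1.sub (contDiff_const.mul hχ.1), ?_, h.trans (union_subset hφ.2.2 hχ.2.2)⟩
  exact (hφ.2.1.isCompact.union hχ.2.1.isCompact).of_isClosed_subset (isClosed_tsupport _) h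

/-- The primitive of a test function of zero mean is a test function. -/
theorem IsTestFun.primitive {L : ℝ} (hL : 0 < L) {ψ : ℝ → ℝ} (hψ : IsTestFun L ψ)
    (h0 : ∫ x in Ioo 0 L, ψ x = 0) : IsTestFun L (fun x => ∫ y in (0 : ℝ)..x, ψ y) := by
  have hc := hψ.1.continuous
  have hd : ∀ x, HasDerivAt (fun x => ∫ y in (0 : ℝ)..x, ψ y) (ψ x) x := fun x =>
    intervalIntegral.integral_hasDerivAt_right (hc.intervalIntegrable _ _)
      (hc.stronglyMeasurableAtFilter _ _) hc.continuousAt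
  -- The point `L / 2` only makes the compact set nonempty when `ψ = 0`; its extreme points `a`, `b`
  -- then bound the support of `ψ`.
  have hK : IsCompact (insert (L / 2) (tsupport ψ)) := hψ.2.1.isCompact.insert _
  have hKs : insert (L / 2) (tsupport ψ) ⊆ Ioo 0 L :=
    insert_subset ⟨by linarith, by linarith⟩ hψ.2.2
  obtain ⟨a, haK, ha⟩ := hK.exists_isLeast (insert_nonempty _ _)
  obtain ⟨b, hbK, hb⟩ := hK.exists_isGreatest (insert_nonempty _ _)
  have hz : ∀ x, x ∉ Icc a b → ψ x = 0 := fun x hx =>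
    image_eq_zero_of_notMem_tsupport
      (fun h => hx ⟨ha (mem_insert_of_mem _ h), hb (mem_insert_of_mem _ h)⟩)
  have ha0 := (hKs haK).1
  have hbL := (hKs hbK).2
  have hsub : tsupport (fun x => ∫ y in (0 : ℝ)..x, ψ y) ⊆ Icc a b := by
    refine closure_minimal (fun x hx => ?_) isClosed_Icc
    by_contra hn
    refine hx ?_
    rcases lt_or_ge x a with h | h
    · refine intervalIntegral.integral_zero_ae (ae_of_all _ fun y hy => hz y fun hy' => ?_)
      rcases le_total 0 x with h' | h'
      · rw [uIoc_of_le h'] at hy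
        linarith [hy.2, hy'.1]
      · rw [uIoc_of_ge h'] at hy
        linarith [hy.2, hy'.1]
    -- To the right of `b` the primitive has already reached the total integral of `ψ`, which is
    -- zero.
    · have hx' : b < x := by
        by_contra hxb
        exact hn ⟨h, not_lt.1 hxb⟩
      have e : ∫ y in (0 : ℝ)..L, ψ y = 0 := by
        rw [intervalIntegral.integral_of_le hL.le, integral_Ioc_eq_integral_Ioo, h0]
      change ∫ y in (0 : ℝ)..x, ψ y = 0
      rw [← intervalIntegral.integral_add_adjacent_intervals (hc.intervalIntegrable 0 L)
        (hc.intervalIntegrable L x), e, zero_add]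
      refine intervalIntegral.integral_zero_ae (ae_of_all _ fun y hy => hz y fun hy' => ?_)
      rcases le_total L x with h' | h'
      · rw [uIoc_of_le h'] at hy
        linarith [hy.1, hy'.2]
      · rw [uIoc_of_ge h'] at hy
        linarith [hy.1, hy'.2]
  refine ⟨?_, isCompact_Icc.of_isClosed_subset (isClosed_tsupport _) hsub,
    hsub.trans fun x hx => ⟨ha0.trans_le hx.1, hx.2.trans_lt hbL⟩⟩
  rw [contDiff_infty_iff_deriv]
  refine ⟨fun x => (hd x).differentiableAt, ?_⟩
  have : deriv (fun x => ∫ y in (0 : ℝ)..x, ψ y) = ψ := funext fun x => (hd x).deriv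
  rw [this]
  exact hψ.1

/-- Otherwise, by scaling, every test function has integral zero, and the constant `1` would vanish
almost everywhere on `(0,L)`. -/
theorem exists_testFun_integral_eq_one {L : ℝ} (hL : 0 < L) :
    ∃ χ, IsTestFun L χ ∧ ∫ x in Ioo 0 L, χ x = 1 := by
  by_contra! hne
  have hz : ∀ φ, IsTestFun L φ → ∫ x in Ioo 0 L, φ x = 0 := by
    intro φ hφ
    by_contra hc
    -- This is `φ` divided by its integral, written as a difference so that `IsTestFun.sub_smul`
    -- applies.
    refine hne (fun x => φ x - (1 - (∫ x in Ioo 0 L, φ x)⁻¹) * φ x) (hφ.sub_smul hφ _) ?_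
    have hi : Integrable φ (volume.restrict (Ioo 0 L)) := hφ.memLp.integrable (by norm_num)
    rw [integral_sub hi (hi.const_mul _), integral_const_mul]
    field_simp
    ring
  have := isOpen_Ioo.ae_eq_zero_of_integral_contDiff_smul_eq_zero (U := Ioo (0 : ℝ) L)
    (f := fun _ => (1 : ℝ)) (μ := volume) ((locallyIntegrable_const _).locallyIntegrableOn _)
    (fun g hg hgc hgs => by
      simp only [smul_eq_mul, mul_one]
      refine Eq.trans (Eq.symm ?_) (hz g ⟨hg, hgc, hgs⟩)
      exact setIntegral_eq_integral_of_forall_compl_eq_zero fun x hx =>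
        image_eq_zero_of_notMem_tsupport (fun h => hx (hgs h)))
  have h0 : volume (Ioo (0 : ℝ) L) = 0 :=
    measure_mono_null (fun x hx => by simpa using hx) (ae_iff.1 this)
  simp [hL.not_ge] at h0

/-- The integral over `(0,L)` as a continuous linear functional on `L²(0,L)`. -/
noncomputable def totalMass (L : ℝ) : L2 L →L[ℝ] ℝ :=
  innerSL ℝ (indicatorConstLp 2 MeasurableSet.univ
    (measure_ne_top (volume.restrict (Ioo (0 : ℝ) L)) univ) (1 : ℝ))

theorem totalMass_apply {L : ℝ} (w : L2 L) : totalMass L w = ∫ x in Ioo 0 L, w x := by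
  rw [totalMass, innerSL_apply_apply, L2.inner_indicatorConstLp_one, setIntegral_univ]

/-- The primitive of an `L²` function of zero mean belongs to `H¹₀`. -/
theorem primitive_mem_H10 {L : ℝ} (hL : 0 < L) (w : L2 L) (hw : ∫ x in Ioo 0 L, w x = 0) :
    (primitive hL w, w) ∈ H10 L := by
  obtain ⟨χ, hχ, hχ1⟩ := exists_testFun_integral_eq_one hL
  let X : L2 L := hχ.memLp.toLp χ
  -- `P` is a continuous projection onto the functions of zero mean which maps test functions to
  -- test functions. The claim therefore holds for `P v` on a dense set of `v`, passes to the limit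
  -- by closedness of `H10`, and `P w = w`.
  let P : L2 L → L2 L := fun v => v - totalMass L v • X
  have hP : Continuous P := by fun_prop
  have hcl : IsClosed {v : L2 L | (primitive hL (P v), P v) ∈ H10 L} :=
    (isClosed_H10 L).preimage (by fun_prop : Continuous fun v => (primitive hL (P v), P v))
  have key : (primitive hL (P w), P w) ∈ H10 L := by
    refine closure_minimal ?_ hcl (dense_testFun L w)
    rintro v ⟨φ, hφ, hv⟩
    refine subset_closure ?_
    have hmass : totalMass L v = ∫ x in Ioo 0 L, φ x := by
      rw [totalMass_apply]
      exact integral_congr_ae hv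
    have hψ := hφ.sub_smul hχ (totalMass L v)
    have hi : Integrable φ (volume.restrict (Ioo 0 L)) := hφ.memLp.integrable (by norm_num)
    have hi' : Integrable χ (volume.restrict (Ioo 0 L)) := hχ.memLp.integrable (by norm_num)
    have h0 : ∫ x in Ioo 0 L, (φ x - totalMass L v * χ x) = 0 := by
      rw [integral_sub hi (hi'.const_mul _), integral_const_mul, hχ1, hmass]
      ring
    have hPv : P v =ᵐ[volume.restrict (Ioo 0 L)] fun x => φ x - totalMass L v * χ x := by
      filter_upwards [hv, Lp.coeFn_sub v (totalMass L v • X), Lp.coeFn_smul (totalMass L v) X,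
        hχ.memLp.coeFn_toLp] with x a b c d
      rw [b, Pi.sub_apply, c, Pi.smul_apply, d, a, smul_eq_mul]
    have hcψ := hψ.1.continuous
    refine ⟨_, hψ.primitive hL h0, ?_, ?_⟩
    · filter_upwards [coeFn_primitive hL (P v), ae_restrict_mem measurableSet_Ioo] with x hx hx'
      rw [hx]
      refine intervalIntegral.integral_congr_ae ?_
      filter_upwards [(ae_restrict_iff' measurableSet_Ioo).1 hPv] with y hy hy'
      rw [uIoc_of_le hx'.1.le] at hy'
      exact hy ⟨hy'.1, hy'.2.trans_lt hx'.2⟩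
    · filter_upwards [hPv] with x hx
      rw [hx, (intervalIntegral.integral_hasDerivAt_right (hcψ.intervalIntegrable _ _)
        (hcψ.stronglyMeasurableAtFilter _ _) hcψ.continuousAt).deriv]
  have hPw : P w = w := by
    simp [P, totalMass_apply, hw]
  rwa [hPw] at key

/-! ### Sines and cosines in `L²(0,L)` -/

/-- Completeness of the sine system in `L²(0,L)`. -/
theorem eq_zero_of_forall_integral_sin_mul_eq_zero {L : ℝ} (hL : 0 < L) (f : L2 L)
    (h : ∀ n : ℕ, ∫ x in Ioo 0 L, Real.sin ((n + 1) * Real.pi / L * x) * f x = 0) : f = 0 := by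
  have hZ : ∀ n : ℤ, ∫ x in Ioo 0 L, Real.sin (n * Real.pi / L * x) * f x = 0 := by
    have hpos : ∀ n : ℕ, ∫ x in Ioo 0 L, Real.sin (n * Real.pi / L * x) * f x = 0 := by
      rintro (_ | n)
      · simp
      · simpa using h n
    intro n
    obtain ⟨m, rfl | rfl⟩ := n.eq_nat_or_neg
    · simpa using hpos m
    · have : ∀ x, Real.sin (((-(m : ℤ) : ℤ) : ℝ) * Real.pi / L * x) * f x
          = -(Real.sin (m * Real.pi / L * x) * f x) := fun x => by
        rw [← neg_mul, ← Real.sin_neg]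
        push_cast
        ring_nf
      simp_rw [this, integral_neg, hpos m, neg_zero]
  let g : ℝ → ℝ := (Ioo 0 L).indicator f
  have hg : MemLp g 2 volume := (memLp_indicator_iff_restrict measurableSet_Ioo).2 (Lp.memLp f)
  have hgn : MemLp (fun x => g (-x)) 2 volume :=
    hg.comp_measurePreserving (Measure.measurePreserving_neg volume)
  -- Odd extension of `f` to `(-L, L)`. Its Fourier coefficients there are multiples of the sine
  -- integrals of `f`, so Parseval's identity forces `G = 0`.
  let G : ℝ → ℂ := fun x => ((g x - g (-x) : ℝ) : ℂ)
  have hG : MemLp G 2 volume := (hg.sub hgn).ofReal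
  have hlt : -L < L := by linarith
  have hcoef : ∀ n : ℤ, fourierCoeffOn hlt G n = 0 := by
    intro n
    rw [fourierCoeffOn_eq_integral, intervalIntegral.integral_of_le hlt.le]
    have hz : ∀ x ∉ Ioc (-L) L, fourier (-n) (x : AddCircle (L - -L)) • G x = 0 := by
      intro x hx
      have h1 : x ∉ Ioo 0 L := fun h' => hx ⟨by linarith [h'.1], h'.2.le⟩
      have h2 : -x ∉ Ioo 0 L := fun h' => hx ⟨by linarith [h'.2], by linarith [h'.1]⟩
      simp [G, g, indicator_of_notMem h1, indicator_of_notMem h2]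
    rw [setIntegral_eq_integral_of_forall_compl_eq_zero hz]
    let E : ℝ → ℂ := fun x => fourier (-n) (x : AddCircle (L - -L))
    have hEc : Continuous E := by
      exact (map_continuous (fourier (-n))).comp (AddCircle.continuous_mk' _)
    have hE1 : ∀ x, ‖E x‖ ≤ 1 := fun x => by
      simp only [E, fourier_apply]
      exact (Circle.norm_coe _).le
    have hgi : Integrable g volume :=
      (integrable_indicator_iff measurableSet_Ioo).2 (integrableOn_L2 f)
    have hI : ∀ F : ℝ → ℂ, Continuous F → (∀ x, ‖F x‖ ≤ 1) →
        Integrable (fun x => F x * (g x : ℂ)) volume := fun F hF hF1 =>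
      hgi.ofReal.bdd_mul hF.aestronglyMeasurable (c := 1) (ae_of_all _ hF1)
    have hi1 := hI E hEc hE1
    have hi2 := hI (fun x => E (-x)) (hEc.comp continuous_neg) (fun x => hE1 _)
    have hi3 : Integrable (fun x => E x * (g (-x) : ℂ)) volume := by
      simpa using hi2.comp_neg
    -- The reflection `x ↦ -x` moves the antisymmetry from `G` to the exponential, leaving `-2i sin
    -- (nπx/L)` on `(0,L)`.
    have e1 : ∫ x : ℝ, fourier (-n) (x : AddCircle (L - -L)) • G x
        = ∫ x, (E x - E (-x)) * (g x : ℂ) := by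
      have e2 : ∫ x, E x * (g (-x) : ℂ) = ∫ x, E (-x) * (g x : ℂ) := by
        rw [← integral_neg_eq_self (fun x => E x * (g (-x) : ℂ))]
        simp
      simp_rw [sub_mul]
      rw [integral_sub hi1 hi2, ← e2, ← integral_sub hi1 hi3]
      refine integral_congr_ae (ae_of_all _ fun x => ?_)
      simp only [G, E, smul_eq_mul]
      push_cast
      ring
    have e3 : ∀ x, (E x - E (-x)) * (g x : ℂ)
        = (-2 * Complex.I) * ((Ioo 0 L).indicator
            (fun x => Real.sin (n * Real.pi / L * x) * f x) x : ℝ) := by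
      intro x
      by_cases hx : x ∈ Ioo 0 L
      · have hs : E x - E (-x) = -2 * Complex.I * (Real.sin (n * Real.pi / L * x) : ℂ) := by
          simp only [E]
          rw [fourier_coe_apply, fourier_coe_apply, Complex.ofReal_sin, Complex.sin]
          have hL' : (L : ℂ) ≠ 0 := by exact_mod_cast hL.ne'
          have a1 : (2 * Real.pi * Complex.I * ((-n : ℤ) : ℂ) * (x : ℂ) / ((L - -L : ℝ) : ℂ))
              = -((n * Real.pi / L * x : ℝ) : ℂ) * Complex.I := by
            push_cast
            field_simp
            ring
          have a2 : (2 * Real.pi * Complex.I * ((-n : ℤ) : ℂ) * ((-x : ℝ) : ℂ) / ((L - -L : ℝ) : ℂ))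
              = ((n * Real.pi / L * x : ℝ) : ℂ) * Complex.I := by
            push_cast
            field_simp
            ring
          rw [a1, a2]
          ring_nf
          rw [Complex.I_sq]
          ring
        rw [hs, indicator_of_mem hx]
        simp only [g, indicator_of_mem hx]
        push_cast
        ring
      · simp [g, indicator_of_notMem hx]
    rw [e1]
    simp_rw [e3]
    rw [integral_const_mul, integral_complex_ofReal, integral_indicator measurableSet_Ioo, hZ n]
    simp
  have hP := hasSum_sq_fourierCoeffOn hlt (hG.restrict (Ioc (-L) L))
  simp_rw [hcoef] at hP
  have hint : ∫ x in (-L)..L, ‖G x‖ ^ 2 = 0 := by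
    have := hP.unique (by simp : HasSum (fun _ : ℤ => ‖(0 : ℂ)‖ ^ 2) 0)
    rw [smul_eq_mul, mul_eq_zero] at this
    rcases this with h' | h'
    · exact absurd h' (inv_ne_zero (by linarith))
    · exact h'
  rw [intervalIntegral.integral_of_le hlt.le, integral_eq_zero_iff_of_nonneg
    (fun x => by positivity) ((hG.restrict _).integrable_norm_pow (by norm_num))] at hint
  rw [Lp.eq_zero_iff_ae_eq_zero]
  have hae := ae_restrict_of_ae_restrict_of_subset
    (show Ioo 0 L ⊆ Ioc (-L) L from fun x hx => ⟨by linarith [hx.1], hx.2.le⟩) hint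
  filter_upwards [hae, ae_restrict_mem measurableSet_Ioo] with x hx hx'
  have h2 : -x ∉ Ioo 0 L := fun h' => by linarith [h'.1, hx'.1]
  simpa [G, g, indicator_of_mem hx', indicator_of_notMem h2] using hx

theorem memLp_sin (L k : ℝ) :
    MemLp (fun x => Real.sin (k * x)) 2 (volume.restrict (Ioo (0 : ℝ) L)) :=
  MemLp.of_bound (by fun_prop) 1 (ae_of_all _ fun x => Real.abs_sin_le_one _)

theorem memLp_cos (L k : ℝ) :
    MemLp (fun x => Real.cos (k * x)) 2 (volume.restrict (Ioo (0 : ℝ) L)) :=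
  MemLp.of_bound (by fun_prop) 1 (ae_of_all _ fun x => Real.abs_cos_le_one _)

/-- `x ↦ sin (k x)` in `L²(0,L)`. -/
noncomputable def sinL2 (L k : ℝ) : L2 L := (memLp_sin L k).toLp _

/-- `x ↦ cos (k x)` in `L²(0,L)`. -/
noncomputable def cosL2 (L k : ℝ) : L2 L := (memLp_cos L k).toLp _

/-- The condition on `k` says that `k cos (k x)` has zero mean, and its primitive is `sin (k x)`. -/
theorem sinL2_mem_H10 {L : ℝ} (hL : 0 < L) {k : ℝ} (hk : Real.sin (k * L) = 0) :
    (sinL2 L k, k • cosL2 L k) ∈ H10 L := by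
  have hint : ∀ x, ∫ y in (0 : ℝ)..x, k * Real.cos (k * y) = Real.sin (k * x) := by
    intro x
    have hd : ∀ y ∈ uIcc 0 x, HasDerivAt (fun y => Real.sin (k * y)) (k * Real.cos (k * y)) y := by
      intro y _
      have := ((hasDerivAt_id y).const_mul k).sin
      simpa [mul_comm] using this
    rw [intervalIntegral.integral_eq_sub_of_hasDerivAt hd
      (by apply Continuous.intervalIntegrable; fun_prop)]
    simp
  have hw : ∀ᵐ x ∂(volume.restrict (Ioo 0 L)), (k • cosL2 L k) x = k * Real.cos (k * x) := by
    filter_upwards [Lp.coeFn_smul k (cosL2 L k), (memLp_cos L k).coeFn_toLp] with x a b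
    rw [a, Pi.smul_apply, cosL2, b, smul_eq_mul]
  have h0 : ∫ x in Ioo 0 L, (k • cosL2 L k) x = 0 := by
    rw [integral_congr_ae hw, ← integral_Ioc_eq_integral_Ioo,
      ← intervalIntegral.integral_of_le hL.le, hint, hk]
  have := primitive_mem_H10 hL _ h0
  convert this using 2
  refine Lp.ext ?_
  filter_upwards [coeFn_primitive hL (k • cosL2 L k), (memLp_sin L k).coeFn_toLp,
    ae_restrict_mem measurableSet_Ioo] with x a b hx
  rw [a, sinL2, b, ← hint x]
  refine intervalIntegral.integral_congr_ae ?_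
  filter_upwards [(ae_restrict_iff' measurableSet_Ioo).1 hw] with y hy hy'
  rw [uIoc_of_le hx.1.le] at hy'
  exact (hy ⟨hy'.1, hy'.2.trans_lt hx.2⟩).symm

theorem hasWeakDeriv_cosL2 {L : ℝ} (hL : 0 < L) (k : ℝ) :
    HasWeakDeriv L (cosL2 L k) (-(k • sinL2 L k)) := by
  intro φ hφ
  have hc : ∀ᵐ x ∂(volume.restrict (Ioo 0 L)),
      cosL2 L k x * deriv φ x = Real.cos (k * x) * deriv φ x := by
    filter_upwards [(memLp_cos L k).coeFn_toLp] with x b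
    rw [cosL2, b]
  have hs : ∀ᵐ x ∂(volume.restrict (Ioo 0 L)),
      (-(k • sinL2 L k)) x * φ x = -(k * Real.sin (k * x)) * φ x := by
    filter_upwards [Lp.coeFn_neg (k • sinL2 L k), Lp.coeFn_smul k (sinL2 L k),
      (memLp_sin L k).coeFn_toLp] with x c a b
    rw [c, Pi.neg_apply, a, Pi.smul_apply, sinL2, b, smul_eq_mul]
  have hd : ∀ y, HasDerivAt (fun y => Real.cos (k * y)) (-(k * Real.sin (k * y))) y := fun y => by
    have := ((hasDerivAt_id y).const_mul k).cos
    simpa [mul_comm] using this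
  rw [integral_congr_ae hc, integral_congr_ae hs, ← integral_Ioc_eq_integral_Ioo,
    ← integral_Ioc_eq_integral_Ioo, ← intervalIntegral.integral_of_le hL.le,
    ← intervalIntegral.integral_of_le hL.le]
  have h0 : φ 0 = 0 := image_eq_zero_of_notMem_tsupport (fun h => lt_irrefl _ (hφ.2.2 h).1)
  have h1 : φ L = 0 := image_eq_zero_of_notMem_tsupport (fun h => lt_irrefl _ (hφ.2.2 h).2)
  rw [intervalIntegral.integral_mul_deriv_eq_deriv_mul (fun x _ => hd x)
    (fun x _ => ((hφ.1.differentiable (by simp)) x).hasDerivAt)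
    (by apply Continuous.intervalIntegrable; fun_prop)
    ((hφ.1.continuous_deriv (by simp)).intervalIntegrable _ _), h0, h1]
  simp

/-! ### Time integrals of `L²`-valued functions -/

theorem intervalIntegral_inner {L a b : ℝ} {f : ℝ → L2 L} (hf : IntervalIntegrable f volume a b)
    (φ : L2 L) : ∫ s in a..b, inner ℝ (f s) φ = inner ℝ (∫ s in a..b, f s) φ := by
  have := (innerSL ℝ φ : L2 L →L[ℝ] ℝ).intervalIntegral_comp_comm hf
  simpa only [innerSL_apply_apply, real_inner_comm φ] using this

theorem MemL2L2.intervalIntegrable {L T : ℝ} {g : ℝ → L2 L} (hg : MemL2L2 L T g) {t : ℝ}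
    (ht : t ∈ Icc 0 T) : IntervalIntegrable g volume 0 t := by
  rw [intervalIntegrable_iff_integrableOn_Ioo_of_le ht.1]
  exact (show IntegrableOn g (Ioo 0 T) volume from hg.integrable (by norm_num)).mono_set
    (Ioo_subset_Ioo_right ht.2)

theorem memL2L2_of_continuousOn {L T : ℝ} {g : ℝ → L2 L} (hg : ContinuousOn g (Icc 0 T)) :
    MemL2L2 L T g := by
  obtain ⟨C, hC⟩ := isCompact_Icc.exists_bound_of_continuousOn hg
  refine MemLp.of_bound ((hg.mono Ioo_subset_Icc_self).aestronglyMeasurable measurableSet_Ioo) C ?_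
  filter_upwards [ae_restrict_mem measurableSet_Ioo] with x hx
  exact hC x (Ioo_subset_Icc_self hx)

/-! ### The Dirichlet heat equation with `L²` initial data -/

/-- `S` is a classical solution of the heat equation `S_t = ν S_xx` with Dirichlet conditions,
with space derivatives `D` and `S₂`. -/
structure IsStrongHeat (L ν : ℝ) (S D S₂ : ℝ → L2 L) : Prop where
  hasDerivAt : ∀ t, HasDerivAt S (ν • S₂ t) t
  continuous_fst : Continuous D
  continuous_snd : Continuous S₂
  mem_H10 : ∀ t, (S t, D t) ∈ H10 L
  inner_eq : ∀ t φ φx, (φ, φx) ∈ H10 L → inner ℝ (D t) φx = -inner ℝ (S₂ t) φ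

namespace IsStrongHeat

variable {L ν : ℝ} {S D S₂ S' D' S₂' : ℝ → L2 L}

theorem continuous (h : IsStrongHeat L ν S D S₂) : Continuous S :=
  continuous_iff_continuousAt.2 fun t => (h.hasDerivAt t).continuousAt

theorem add (h : IsStrongHeat L ν S D S₂) (h' : IsStrongHeat L ν S' D' S₂') :
    IsStrongHeat L ν (S + S') (D + D') (S₂ + S₂') where
  hasDerivAt t := by
    simpa [smul_add] using (h.hasDerivAt t).add (h'.hasDerivAt t)
  continuous_fst := h.continuous_fst.add h'.continuous_fst
  continuous_snd := h.continuous_snd.add h'.continuous_snd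
  mem_H10 t := (H10 L).add_mem (h.mem_H10 t) (h'.mem_H10 t)
  inner_eq t φ φx hφ := by
    simp only [Pi.add_apply, inner_add_left, h.inner_eq t φ φx hφ, h'.inner_eq t φ φx hφ]
    ring

theorem smul (h : IsStrongHeat L ν S D S₂) (c : ℝ) :
    IsStrongHeat L ν (c • S) (c • D) (c • S₂) where
  hasDerivAt t := by
    simpa [smul_comm ν c] using (h.hasDerivAt t).const_smul c
  continuous_fst := h.continuous_fst.const_smul c
  continuous_snd := h.continuous_snd.const_smul c
  mem_H10 t := (H10 L).smul_mem c (h.mem_H10 t)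
  inner_eq t φ φx hφ := by
    simp only [Pi.smul_apply, real_inner_smul_left, h.inner_eq t φ φx hφ]
    ring

theorem sub (h : IsStrongHeat L ν S D S₂) (h' : IsStrongHeat L ν S' D' S₂') :
    IsStrongHeat L ν (S - S') (D - D') (S₂ - S₂') := by
  have := h.add (h'.smul (-1))
  simpa [sub_eq_add_neg] using this

/-- Differentiate `‖S‖²` and integrate by parts in space with the test pair `(S, D)`. -/
theorem energy_eq (h : IsStrongHeat L ν S D S₂) (t : ℝ) :
    ‖S t‖ ^ 2 + 2 * ν * ∫ s in (0 : ℝ)..t, ‖D s‖ ^ 2 = ‖S 0‖ ^ 2 := by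
  have hd : ∀ s ∈ uIcc 0 t, HasDerivAt (fun s => ‖S s‖ ^ 2) (-(2 * ν) * ‖D s‖ ^ 2) s := by
    intro s _
    have := (h.hasDerivAt s).norm_sq
    convert this using 1
    rw [real_inner_smul_right, real_inner_comm, ← real_inner_self_eq_norm_sq,
      h.inner_eq s _ _ (h.mem_H10 s)]
    ring
  have hc := h.continuous_fst
  have := intervalIntegral.integral_eq_sub_of_hasDerivAt hd
    (by apply Continuous.intervalIntegrable; fun_prop)
  rw [intervalIntegral.integral_const_mul] at this
  linarith

/-- Product rule for `(1 - s/T) ⟨S s, φ⟩`; differentiating the ramp produces the source. The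
identity no longer contains `S₂`, so it survives the passage to `L²` initial data. -/
theorem weak_weighted (h : IsStrongHeat L ν S D S₂) {φ φx : L2 L} (hφ : (φ, φx) ∈ H10 L)
    (T t : ℝ) :
    (1 - t / T) * inner ℝ (S t) φ - inner ℝ (S 0) φ
      + ν * (∫ s in (0 : ℝ)..t, (1 - s / T) * inner ℝ (D s) φx)
      = -(1 / T) * ∫ s in (0 : ℝ)..t, inner ℝ (S s) φ := by
  have hd : ∀ s ∈ uIcc 0 t, HasDerivAt (fun s => (1 - s / T) * inner ℝ (S s) φ)
      (-(1 / T) * inner ℝ (S s) φ - ν * ((1 - s / T) * inner ℝ (D s) φx)) s := by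
    intro s _
    have h1 : HasDerivAt (fun s : ℝ => 1 - s / T) (-(1 / T)) s := by
      simpa using ((hasDerivAt_id s).div_const T).const_sub 1
    have h2 : HasDerivAt (fun s => inner ℝ (S s) φ) (inner ℝ (ν • S₂ s) φ) s := by
      simpa using (h.hasDerivAt s).inner ℝ (hasDerivAt_const s φ)
    refine (h1.mul h2).congr_deriv ?_
    rw [real_inner_smul_left, h.inner_eq s φ φx hφ]
    ring
  have hc := h.continuous_fst
  have hc' := h.continuous
  have := intervalIntegral.integral_eq_sub_of_hasDerivAt hd
    (by apply Continuous.intervalIntegrable; fun_prop)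
  rw [intervalIntegral.integral_sub (by apply Continuous.intervalIntegrable; fun_prop)
    (by apply Continuous.intervalIntegrable; fun_prop), intervalIntegral.integral_const_mul,
    intervalIntegral.integral_const_mul] at this
  simp only [zero_div, sub_zero, one_mul] at this
  linarith

end IsStrongHeat

theorem isStrongHeat_sin {L : ℝ} (hL : 0 < L) (ν : ℝ) {k : ℝ} (hk : Real.sin (k * L) = 0) :
    IsStrongHeat L ν (fun t => Real.exp (-(ν * k ^ 2) * t) • sinL2 L k)
      (fun t => Real.exp (-(ν * k ^ 2) * t) • k • cosL2 L k)
      (fun t => Real.exp (-(ν * k ^ 2) * t) • -(k ^ 2 • sinL2 L k)) where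
  hasDerivAt t := by
    have h1 : HasDerivAt (fun t : ℝ => Real.exp (-(ν * k ^ 2) * t))
        (Real.exp (-(ν * k ^ 2) * t) * -(ν * k ^ 2)) t := by
      simpa using ((hasDerivAt_id t).const_mul (-(ν * k ^ 2))).exp
    refine (h1.smul_const (sinL2 L k)).congr_deriv ?_
    rw [← neg_smul, smul_smul, smul_smul]
    congr 1
    ring
  continuous_fst := by fun_prop
  continuous_snd := by fun_prop
  mem_H10 t := (H10 L).smul_mem _ (sinL2_mem_H10 hL hk)
  inner_eq t φ φx hφ := by
    have := (hasWeakDeriv_cosL2 hL k).inner_eq hφ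
    simp only [real_inner_smul_left, inner_neg_left] at this ⊢
    rw [this]
    ring

/-- The initial values of classical solutions of the heat equation. -/
def strongData {L : ℝ} (hL : 0 < L) (ν : ℝ) : Submodule ℝ (L2 L) where
  carrier := {v | ∃ S D S₂, IsStrongHeat L ν S D S₂ ∧ S 0 = v}
  zero_mem' := by
    refine ⟨_, _, _, (isStrongHeat_sin hL ν (k := 0) (by simp)).smul 0, by simp⟩
  add_mem' := by
    rintro _ _ ⟨S, D, S₂, h, rfl⟩ ⟨S', D', S₂', h', rfl⟩
    exact ⟨_, _, _, h.add h', rfl⟩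
  smul_mem' := by
    rintro c _ ⟨S, D, S₂, h, rfl⟩
    exact ⟨_, _, _, h.smul c, rfl⟩

/-- Every Dirichlet sine mode is an initial value of a classical solution, and the sines are
complete. -/
theorem dense_strongData {L : ℝ} (hL : 0 < L) (ν : ℝ) :
    Dense (strongData hL ν : Set (L2 L)) := by
  rw [Submodule.dense_iff_topologicalClosure_eq_top, Submodule.topologicalClosure_eq_top_iff,
    Submodule.eq_bot_iff]
  intro f hf
  refine eq_zero_of_forall_integral_sin_mul_eq_zero hL f fun n => ?_
  have hk : Real.sin ((n + 1) * Real.pi / L * L) = 0 := by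
    rw [div_mul_cancel₀ _ hL.ne']
    exact_mod_cast Real.sin_nat_mul_pi (n + 1)
  have h0 := (Submodule.mem_orthogonal _ _).1 hf (sinL2 L ((n + 1) * Real.pi / L))
    ⟨_, _, _, isStrongHeat_sin hL ν hk, by simp⟩
  rw [inner_eq_integral] at h0
  refine Eq.trans (integral_congr_ae ?_) h0
  filter_upwards [(memLp_sin L ((n + 1) * Real.pi / L)).coeFn_toLp] with x hx
  rw [sinL2, hx]

/-- Classical solutions of the heat equation approximating the one with initial value `u₀`. -/
theorem exists_heat_approx {L ν T : ℝ} (hL : 0 < L) (hν : 0 < ν) (hT : 0 < T) (u₀ : L2 L) :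
    ∃ (S D S₂ : ℕ → ℝ → L2 L) (Z : ℝ → L2 L)
      (d : ℕ → Lp (L2 L) 2 (volume.restrict (Ioo (0 : ℝ) T)))
      (Dl : Lp (L2 L) 2 (volume.restrict (Ioo (0 : ℝ) T))),
      (∀ n, IsStrongHeat L ν (S n) (D n) (S₂ n)) ∧
      (∀ t, 0 ≤ t → Tendsto (fun n => S n t) atTop (𝓝 (Z t))) ∧
      (∃ C, ∀ n t, 0 ≤ t → ‖S n t‖ ≤ C) ∧ ContinuousOn Z (Icc 0 T) ∧ Z 0 = u₀ ∧
      (∀ n, d n =ᵐ[volume.restrict (Ioo (0 : ℝ) T)] D n) ∧ Tendsto d atTop (𝓝 Dl) := by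
  obtain ⟨v, hv, hvu⟩ := mem_closure_iff_seq_limit.1 (dense_strongData hL ν u₀)
  choose S D S₂ hS hS0 using hv
  have hvC : CauchySeq v := hvu.cauchySeq
  -- convergence of the solutions, uniformly in time
  have hdiff : ∀ m n t, 0 ≤ t → dist (S m t) (S n t) ≤ dist (v m) (v n) := by
    intro m n t ht
    -- The energy identity for the difference, without its nonnegative dissipation term, shows that
    -- the flow is a contraction in `L²`.
    have he := ((hS m).sub (hS n)).energy_eq t
    have hi : 0 ≤ ∫ s in (0 : ℝ)..t, ‖(D m - D n) s‖ ^ 2 :=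
      intervalIntegral.integral_nonneg ht fun s _ => by positivity
    simp only [Pi.sub_apply, hS0, ← dist_eq_norm] at he hi
    refine (sq_le_sq₀ dist_nonneg dist_nonneg).1 ?_
    nlinarith [mul_nonneg hν.le hi]
  have hSC : ∀ t, 0 ≤ t → CauchySeq fun n => S n t := by
    intro t ht
    rw [Metric.cauchySeq_iff] at hvC ⊢
    intro ε hε
    obtain ⟨N, hN⟩ := hvC ε hε
    exact ⟨N, fun m hm n hn => (hdiff m n t ht).trans_lt (hN m hm n hn)⟩
  have hlim : ∀ t, ∃ z, 0 ≤ t → Tendsto (fun n => S n t) atTop (𝓝 z) := by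
    intro t
    by_cases ht : 0 ≤ t
    · obtain ⟨z, hz⟩ := cauchySeq_tendsto_of_complete (hSC t ht)
      exact ⟨z, fun _ => hz⟩
    · exact ⟨0, fun h => absurd h ht⟩
  choose Z hZ using hlim
  have hunif : TendstoUniformlyOn S Z atTop (Icc 0 T) := by
    refine UniformCauchySeqOn.tendstoUniformlyOn_of_tendsto ?_ fun t ht => hZ t ht.1
    rw [Metric.uniformCauchySeqOn_iff]
    intro ε hε
    obtain ⟨N, hN⟩ := Metric.cauchySeq_iff.1 hvC ε hε
    exact ⟨N, fun m hm n hn t ht => (hdiff m n t ht.1).trans_lt (hN m hm n hn)⟩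
  have hZc : ContinuousOn Z (Icc 0 T) :=
    hunif.continuousOn (Frequently.of_forall fun n => (hS n).continuous.continuousOn)
  have hZ0 : Z 0 = u₀ := tendsto_nhds_unique (hZ 0 le_rfl) (by simpa only [hS0] using hvu)
  -- convergence of the space derivatives in `L²(0,T; L²)`
  have hDm : ∀ n, MemLp (D n) 2 (volume.restrict (Ioo (0 : ℝ) T)) := fun n =>
    memL2L2_of_continuousOn (hS n).continuous_fst.continuousOn
  let d : ℕ → Lp (L2 L) 2 (volume.restrict (Ioo (0 : ℝ) T)) := fun n => (hDm n).toLp _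
  -- The same identity at time `T`, now keeping the dissipation and dropping the final norm.
  have hdd : ∀ m n, ‖d m - d n‖ ^ 2 ≤ (2 * ν)⁻¹ * ‖v m - v n‖ ^ 2 := by
    intro m n
    have e : ‖d m - d n‖ ^ 2 = ∫ s in (0 : ℝ)..T, ‖(D m - D n) s‖ ^ 2 := by
      rw [← real_inner_self_eq_norm_sq, L2.inner_def, intervalIntegral.integral_of_le hT.le,
        integral_Ioc_eq_integral_Ioo]
      refine integral_congr_ae ?_
      filter_upwards [Lp.coeFn_sub (d m) (d n), (hDm m).coeFn_toLp, (hDm n).coeFn_toLp]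
        with s a b c
      rw [a, Pi.sub_apply, b, c, real_inner_self_eq_norm_sq, Pi.sub_apply]
    have he := ((hS m).sub (hS n)).energy_eq T
    rw [e, inv_mul_eq_div, le_div_iff₀ (by positivity)]
    simp only [Pi.sub_apply, hS0] at he ⊢
    nlinarith [sq_nonneg ‖S m T - S n T‖]
  have hdC : CauchySeq d := by
    rw [Metric.cauchySeq_iff] at hvC ⊢
    intro ε hε
    obtain ⟨N, hN⟩ := hvC (Real.sqrt (2 * ν) * ε) (by positivity)
    refine ⟨N, fun m hm n hn => ?_⟩
    have h1 := hN m hm n hn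
    rw [dist_eq_norm] at h1 ⊢
    refine lt_of_pow_lt_pow_left₀ 2 hε.le ((hdd m n).trans_lt ?_)
    rw [inv_mul_lt_iff₀ (by positivity)]
    calc ‖v m - v n‖ ^ 2 < (Real.sqrt (2 * ν) * ε) ^ 2 := by gcongr
      _ = 2 * ν * ε ^ 2 := by rw [mul_pow, Real.sq_sqrt (by positivity)]
  obtain ⟨Dl, hDl⟩ := cauchySeq_tendsto_of_complete hdC
  refine ⟨S, D, S₂, Z, d, Dl, hS, hZ, ?_, hZc, hZ0, fun n => (hDm n).coeFn_toLp, hDl⟩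
  obtain ⟨C, hC⟩ := hvC.isBounded_range.exists_norm_le
  refine ⟨C, fun n t ht => le_trans ?_ (hC _ (mem_range_self n))⟩
  have he := (hS n).energy_eq t
  have hi : 0 ≤ ∫ s in (0 : ℝ)..t, ‖D n s‖ ^ 2 :=
    intervalIntegral.integral_nonneg ht fun s _ => by positivity
  rw [hS0] at he
  refine (sq_le_sq₀ (norm_nonneg _) (norm_nonneg _)).1 ?_
  nlinarith [mul_nonneg hν.le hi]

theorem memLp_ramp_smul {L T : ℝ} (hT : 0 < T) {f : ℝ → L2 L}
    (hf : MemLp f 2 (volume.restrict (Ioo (0 : ℝ) T))) :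
    MemLp (fun t => (1 - t / T) • f t) 2 (volume.restrict (Ioo (0 : ℝ) T)) := by
  have hc : AEStronglyMeasurable (fun t : ℝ => 1 - t / T) (volume.restrict (Ioo (0 : ℝ) T)) := by
    fun_prop
  refine hf.of_le (hc.smul hf.1) ?_
  filter_upwards [ae_restrict_mem measurableSet_Ioo] with t ht
  rw [norm_smul]
  have h1 : 0 ≤ t / T := div_nonneg ht.1.le hT.le
  have h2 : t / T ≤ 1 := (div_le_one hT).2 ht.2.le
  refine mul_le_of_le_one_left (norm_nonneg _) ?_
  rw [Real.norm_eq_abs, abs_le]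
  constructor <;> linarith

/-- Strong convergence in `L²(0,T; L²)` passes to the limit in the tested integrals. -/
theorem tendsto_integral_ramp_inner {L T t : ℝ} (hT : 0 < T) (ht : t ∈ Icc 0 T)
    {d : ℕ → Lp (L2 L) 2 (volume.restrict (Ioo (0 : ℝ) T))}
    {Dl : Lp (L2 L) 2 (volume.restrict (Ioo (0 : ℝ) T))} (hDl : Tendsto d atTop (𝓝 Dl))
    (φx : L2 L) :
    Tendsto (fun n => ∫ s in (0 : ℝ)..t, (1 - s / T) * inner ℝ (d n s) φx) atTop
      (𝓝 (∫ s in (0 : ℝ)..t, (1 - s / T) * inner ℝ (Dl s) φx)) := by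
  have hsub : Ioo 0 t ⊆ Ioo 0 T := Ioo_subset_Ioo_right ht.2
  -- The tested integral over `(0,t)` is the inner product in `L²(0,T; L²)` with this fixed
  -- function, hence continuous in `d`.
  have hΨ : MemLp ((Ioo 0 t).indicator (fun s : ℝ => (1 - s / T) • φx)) 2
      (volume.restrict (Ioo (0 : ℝ) T)) :=
    (memLp_ramp_smul hT (memLp_const φx)).indicator measurableSet_Ioo
  have hinn : ∀ F : Lp (L2 L) 2 (volume.restrict (Ioo (0 : ℝ) T)),
      inner ℝ F (hΨ.toLp _) = ∫ s in (0 : ℝ)..t, (1 - s / T) * inner ℝ (F s) φx := by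
    intro F
    have e : ∫ s in (0 : ℝ)..t, (1 - s / T) * inner ℝ (F s) φx
        = ∫ s in Ioo 0 T, (Ioo 0 t).indicator (fun s => (1 - s / T) * inner ℝ (F s) φx) s := by
      rw [intervalIntegral.integral_of_le ht.1, integral_Ioc_eq_integral_Ioo,
        integral_indicator measurableSet_Ioo, Measure.restrict_restrict measurableSet_Ioo,
        inter_eq_left.2 hsub]
    rw [L2.inner_def, e]
    refine integral_congr_ae ?_
    filter_upwards [hΨ.coeFn_toLp] with s hs
    rw [hs]
    by_cases h : s ∈ Ioo 0 t
    · simp only [indicator_of_mem h, real_inner_smul_right]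
    · simp only [indicator_of_notMem h, inner_zero_right]
  simp only [← hinn]
  exact hDl.inner tendsto_const_nhds

/-- Dirichlet solutions of the heat equation with arbitrary `L²` initial value, multiplied by
`1 - t/T` so that they vanish at time `T`. -/
theorem exists_heat_flow_to_zero {L ν T : ℝ} (hL : 0 < L) (hν : 0 < ν) (hT : 0 < T) (u₀ : L2 L) :
    ∃ w wx G : ℝ → L2 L, ContinuousOn w (Icc 0 T) ∧ ContinuousOn G (Icc 0 T) ∧
      w 0 = u₀ ∧ w T = 0 ∧ MemL2H10 L T w wx ∧
      ∀ t ∈ Icc 0 T, ∀ φ φx : L2 L, (φ, φx) ∈ H10 L →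
        inner ℝ (w t) φ - inner ℝ u₀ φ + ν * (∫ s in (0 : ℝ)..t, inner ℝ (wx s) φx)
          = ∫ s in (0 : ℝ)..t, inner ℝ (G s) φ := by
  obtain ⟨S, D, S₂, Z, d, Dl, hS, hZ, ⟨C, hC⟩, hZc, hZ0, hd, hDl⟩ :=
    exists_heat_approx hL hν hT u₀
  -- Along a subsequence the derivatives converge for almost every `t`, so membership in the closed
  -- subspace `H10` passes to the limit pointwise in time.
  obtain ⟨ns, hns, hae⟩ := (tendstoInMeasure_of_tendsto_Lp hDl).exists_seq_tendsto_ae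
  have hmem : ∀ᵐ t ∂(volume.restrict (Ioo (0 : ℝ) T)), (Z t, Dl t) ∈ H10 L := by
    filter_upwards [hae, ae_all_iff.2 hd,
      ae_restrict_mem measurableSet_Ioo] with t h1 h2 ht
    have h1' : Tendsto (fun i => D (ns i) t) atTop (𝓝 (Dl t)) := by
      refine h1.congr fun i => ?_
      exact h2 (ns i)
    have h3 : Tendsto (fun i => S (ns i) t) atTop (𝓝 (Z t)) :=
      (hZ t ht.1.le).comp hns.tendsto_atTop
    exact (isClosed_H10 L).mem_of_tendsto (h3.prodMk_nhds h1')
      (Eventually.of_forall fun i => (hS (ns i)).mem_H10 t)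
  have hZm : MemLp Z 2 (volume.restrict (Ioo (0 : ℝ) T)) := memL2L2_of_continuousOn hZc
  refine ⟨fun t => (1 - t / T) • Z t, fun t => (1 - t / T) • Dl t, fun t => (-(1 / T)) • Z t,
    ?_, hZc.const_smul (-(1 / T)), by simp [hZ0], by simp [div_self hT.ne'],
    ⟨memLp_ramp_smul hT hZm, memLp_ramp_smul hT (Lp.memLp Dl), ?_⟩, ?_⟩
  · fun_prop
  · filter_upwards [hmem] with t ht
    exact (H10 L).smul_mem (1 - t / T) ht
  intro t ht φ φx hφ
  simp only [real_inner_smul_left, intervalIntegral.integral_const_mul]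
  have hlimD : Tendsto (fun n => ∫ s in (0 : ℝ)..t, (1 - s / T) * inner ℝ (D n s) φx) atTop
      (𝓝 (∫ s in (0 : ℝ)..t, (1 - s / T) * inner ℝ (Dl s) φx)) := by
    refine (tendsto_integral_ramp_inner hT ht hDl φx).congr fun n => ?_
    refine intervalIntegral.integral_congr_ae_restrict ?_
    rw [uIoc_of_le ht.1, ← restrict_Ioo_eq_restrict_Ioc]
    filter_upwards [ae_restrict_of_ae_restrict_of_subset (Ioo_subset_Ioo_right ht.2) (hd n)]
      with s hs
    rw [hs]
  have hlimS : Tendsto (fun n => ∫ s in (0 : ℝ)..t, inner ℝ (S n s) φ) atTop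
      (𝓝 (∫ s in (0 : ℝ)..t, inner ℝ (Z s) φ)) := by
    refine intervalIntegral.tendsto_integral_filter_of_dominated_convergence
      (fun _ => C * ‖φ‖) (Eventually.of_forall fun n => ?_) (Eventually.of_forall fun n => ?_)
      (by simp) ?_
    · have := (hS n).continuous
      apply Continuous.aestronglyMeasurable
      fun_prop
    · refine ae_of_all _ fun s hs => (norm_inner_le_norm _ _).trans ?_
      rw [uIoc_of_le ht.1] at hs
      gcongr
      exact hC n s hs.1.le
    · refine ae_of_all _ fun s hs => ?_
      rw [uIoc_of_le ht.1] at hs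
      exact (hZ s hs.1.le).inner tendsto_const_nhds
  have hlimt : Tendsto (fun n => (1 - t / T) * inner ℝ (S n t) φ - inner ℝ (S n 0) φ) atTop
      (𝓝 ((1 - t / T) * inner ℝ (Z t) φ - inner ℝ u₀ φ)) := by
    refine (((hZ t ht.1).inner tendsto_const_nhds).const_mul _).sub ?_
    rw [← hZ0]
    exact (hZ 0 le_rfl).inner tendsto_const_nhds
  refine tendsto_nhds_unique (hlimt.add (hlimD.const_mul ν)) ?_
  refine (hlimS.const_mul (-(1 / T))).congr fun n => ?_
  exact ((hS n).weak_weighted hφ T t).symm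

/-! ### Time primitives, Gronwall's lemma and uniqueness -/

/-- The average of a function with values in a closed convex set stays in it, and for `t > 0` the
integral is `t` times the average. -/
theorem MemL2H10.integral_mem {L T : ℝ} {u ux : ℝ → L2 L} (h : MemL2H10 L T u ux) {t : ℝ}
    (ht : t ∈ Icc 0 T) : (∫ s in (0 : ℝ)..t, u s, ∫ s in (0 : ℝ)..t, ux s) ∈ H10 L := by
  rcases ht.1.eq_or_lt with h0 | h0
  · subst h0
    simp only [intervalIntegral.integral_same]
    exact (H10 L).zero_mem
  have hsub : Ioo 0 t ⊆ Ioo 0 T := Ioo_subset_Ioo_right ht.2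
  have h1 : IntegrableOn u (Ioo 0 t) volume :=
    (show IntegrableOn u (Ioo 0 T) volume from h.1.integrable (by norm_num)).mono_set hsub
  have h2 : IntegrableOn ux (Ioo 0 t) volume :=
    (show IntegrableOn ux (Ioo 0 T) volume from h.2.1.integrable (by norm_num)).mono_set hsub
  have hav := (H10 L).convex.set_average_mem (μ := volume) (t := Ioo 0 t)
    (f := fun s => (u s, ux s)) (isClosed_H10 L) (by simp [h0]) (by simp)
    (ae_restrict_of_ae_restrict_of_subset hsub h.2.2) (h1.prodMk h2)
  have := (H10 L).smul_mem (volume.real (Ioo 0 t)) hav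
  rw [measure_smul_setAverage _ (by simp), integral_pair h1 h2] at this
  simpa only [intervalIntegral.integral_of_le ht.1, integral_Ioc_eq_integral_Ioo] using this

section Primitive

variable {L T : ℝ} {f : ℝ → L2 L}

theorem MemL2L2.continuousOn_primitive (hT : 0 ≤ T) (hf : MemL2L2 L T f) :
    ContinuousOn (fun t => ∫ s in (0 : ℝ)..t, f s) (Icc 0 T) := by
  have := intervalIntegral.continuousOn_primitive_interval (a := 0) (b := T) (f := f)
    (μ := volume) (by
      rw [uIcc_of_le hT]
      exact (integrableOn_Icc_iff_integrableOn_Ioo).2 (hf.integrable (by norm_num)))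
  rwa [uIcc_of_le hT] at this

theorem hasDerivAt_primitive (hf : ContinuousOn f (Icc 0 T)) {t : ℝ} (ht : t ∈ Ioo 0 T) :
    HasDerivAt (fun t => ∫ s in (0 : ℝ)..t, f s) (f t) t :=
  intervalIntegral.integral_hasDerivAt_right
    ((memL2L2_of_continuousOn hf).intervalIntegrable (Ioo_subset_Icc_self ht))
    ((hf.mono Ioo_subset_Icc_self).stronglyMeasurableAtFilter isOpen_Ioo t ht)
    (hf.continuousAt (Icc_mem_nhds ht.1 ht.2))

theorem eq_zero_of_primitive_eq_zero (hT : 0 < T) (hf : ContinuousOn f (Icc 0 T))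
    (h : ∀ t ∈ Icc 0 T, ∫ s in (0 : ℝ)..t, f s = 0) : ∀ t ∈ Icc 0 T, f t = 0 := by
  have hIoo : EqOn f (fun _ => 0) (Ioo 0 T) := by
    intro t ht
    refine (hasDerivAt_primitive hf ht).unique
      ((hasDerivAt_const t (0 : L2 L)).congr_of_eventuallyEq ?_)
    filter_upwards [Icc_mem_nhds ht.1 ht.2] with s hs
    exact h s hs
  exact hIoo.of_subset_closure hf continuousOn_const Ioo_subset_Icc_self
    (by rw [closure_Ioo hT.ne])

end Primitive

/-- A nonnegative function that vanishes at `0` and satisfies `E' ≤ K E` is zero. -/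
theorem eq_zero_of_deriv_le_mul {E E' : ℝ → ℝ} {K T : ℝ} (hc : ContinuousOn E (Icc 0 T))
    (hd : ∀ t ∈ Ioo 0 T, HasDerivAt E (E' t) t) (hle : ∀ t ∈ Ioo 0 T, E' t ≤ K * E t)
    (h0 : E 0 = 0) (hnn : ∀ t, 0 ≤ E t) : ∀ t ∈ Icc 0 T, E t = 0 := by
  have hanti : AntitoneOn (fun t => Real.exp (-(K * t)) * E t) (Icc 0 T) := by
    have hd' : ∀ t ∈ Ioo 0 T, HasDerivAt (fun t => Real.exp (-(K * t)) * E t)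
        (Real.exp (-(K * t)) * (E' t - K * E t)) t := by
      intro t ht
      have h1 : HasDerivAt (fun t : ℝ => Real.exp (-(K * t)))
          (Real.exp (-(K * t)) * -K) t := by
        simpa using ((hasDerivAt_id t).const_mul K).neg.exp
      refine (h1.mul (hd t ht)).congr_deriv ?_
      ring
    refine antitoneOn_of_deriv_nonpos (convex_Icc 0 T) (by fun_prop) ?_ ?_
    · rw [interior_Icc]
      exact fun t ht => (hd' t ht).differentiableAt.differentiableWithinAt
    · rw [interior_Icc]
      intro t ht
      rw [(hd' t ht).deriv]
      exact mul_nonpos_of_nonneg_of_nonpos (Real.exp_pos _).le (by linarith [hle t ht])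
  intro t ht
  have := hanti (left_mem_Icc.2 (ht.1.trans ht.2)) ht ht.1
  simp only [h0, mul_zero] at this
  exact le_antisymm (nonpos_of_mul_nonpos_right this (Real.exp_pos _)) (hnn t)

/-- Young's inequality, from `‖2κ y + R z‖² ≥ 0`. -/
theorem neg_mul_inner_le {H : Type*} [NormedAddCommGroup H] [InnerProductSpace ℝ H] {κ : ℝ}
    (hκ : 0 < κ) (R : ℝ) (y z : H) :
    -(R * inner ℝ y z) ≤ κ * ‖y‖ ^ 2 + R ^ 2 / (4 * κ) * ‖z‖ ^ 2 := by
  have := real_inner_self_nonneg (x := (2 * κ) • y + R • z)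
  rw [real_inner_self_eq_norm_sq, norm_add_sq_real, norm_smul, norm_smul,
    real_inner_smul_left, real_inner_smul_right, mul_pow, mul_pow, Real.norm_eq_abs,
    Real.norm_eq_abs, sq_abs, sq_abs] at this
  have h4 : κ * ‖y‖ ^ 2 + R ^ 2 / (4 * κ) * ‖z‖ ^ 2 + R * inner ℝ y z
      = ((2 * κ) ^ 2 * ‖y‖ ^ 2 + 2 * (2 * κ * (R * inner ℝ y z)) + R ^ 2 * ‖z‖ ^ 2) / (4 * κ) := by
    field_simp
    ring
  have : 0 ≤ κ * ‖y‖ ^ 2 + R ^ 2 / (4 * κ) * ‖z‖ ^ 2 + R * inner ℝ y z := by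
    rw [h4]; positivity
  linarith

/-- The homogeneous system, written for the time primitives of its solution, has only the zero
solution. -/
theorem homogeneous_eq_zero {L T ν α R κ c : ℝ} (hT : 0 < T) (hν : 0 < ν) (hα : 0 < α)
    (hκ : 0 < κ) {u θ ux θx : ℝ → L2 L}
    (hu : ContinuousOn u (Icc 0 T)) (hθ : ContinuousOn θ (Icc 0 T))
    (hux : MemL2H10 L T u ux) (hθx : MemL2H10 L T θ θx)
    (h₁ : ∀ t ∈ Icc 0 T, ∀ φ φx : L2 L, (φ, φx) ∈ H10 L →
      inner ℝ (u t) φ + ν * inner ℝ (∫ s in (0 : ℝ)..t, ux s) φx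
        + α * inner ℝ (∫ s in (0 : ℝ)..t, ∫ r in (0 : ℝ)..s, ux r) φx
        + R * inner ℝ (∫ s in (0 : ℝ)..t, θx s) φ = 0)
    (h₂ : ∀ t ∈ Icc 0 T, ∀ φ φx : L2 L, (φ, φx) ∈ H10 L →
      inner ℝ (θ t) φ + κ * inner ℝ (∫ s in (0 : ℝ)..t, θx s) φx
        + c * inner ℝ (∫ s in (0 : ℝ)..t, ux s) φ = 0) :
    ∀ t ∈ Icc 0 T, u t = 0 ∧ θ t = 0 ∧ ∫ s in (0 : ℝ)..t, ux s = 0 := by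
  set U : ℝ → L2 L := fun t => ∫ s in (0 : ℝ)..t, u s with hU
  set X : ℝ → L2 L := fun t => ∫ s in (0 : ℝ)..t, ux s with hX
  set Θ : ℝ → L2 L := fun t => ∫ s in (0 : ℝ)..t, θ s with hΘ
  set Y : ℝ → L2 L := fun t => ∫ s in (0 : ℝ)..t, θx s with hY
  set V : ℝ → L2 L := fun t => ∫ s in (0 : ℝ)..t, X s with hV
  have hXc : ContinuousOn X (Icc 0 T) := hux.2.1.continuousOn_primitive hT.le
  have hUc : ContinuousOn U (Icc 0 T) := hux.1.continuousOn_primitive hT.le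
  have hΘc : ContinuousOn Θ (Icc 0 T) := hθx.1.continuousOn_primitive hT.le
  have hVc : ContinuousOn V (Icc 0 T) :=
    (memL2L2_of_continuousOn hXc).continuousOn_primitive hT.le
  -- Test the first equation with `(U, X)` and the second with `(Θ, Y)`. As `U' = u`, `V' = X` and
  -- `Θ' = θ`, this gives half the derivative of the energy. Young's inequality absorbs `R ⟨Y, U⟩`
  -- into `κ ‖Y‖²` and `c ⟨X, Θ⟩` into `ν ‖X‖²`; twice the remaining coefficients add up to `K`.
  have hE := eq_zero_of_deriv_le_mul (T := T) (K := R ^ 2 / (2 * κ) + c ^ 2 / (2 * ν))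
    (E := fun t => ‖U t‖ ^ 2 + α * ‖V t‖ ^ 2 + ‖Θ t‖ ^ 2)
    (E' := fun t => 2 * inner ℝ (U t) (u t) + α * (2 * inner ℝ (V t) (X t))
      + 2 * inner ℝ (Θ t) (θ t)) (by fun_prop)
    (fun t ht => (((hasDerivAt_primitive hu ht).norm_sq.add
      ((hasDerivAt_primitive hXc ht).norm_sq.const_mul α)).add
      (hasDerivAt_primitive hθ ht).norm_sq))
    (fun t ht => by
      have ht' := Ioo_subset_Icc_self ht
      have e1 := h₁ t ht' (U t) (X t) (hux.integral_mem ht')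
      have e2 := h₂ t ht' (Θ t) (Y t) (hθx.integral_mem ht')
      change inner ℝ (u t) (U t) + ν * inner ℝ (X t) (X t) + α * inner ℝ (V t) (X t)
        + R * inner ℝ (Y t) (U t) = 0 at e1
      change inner ℝ (θ t) (Θ t) + κ * inner ℝ (Y t) (Y t) + c * inner ℝ (X t) (Θ t) = 0 at e2
      rw [real_inner_self_eq_norm_sq] at e1 e2
      rw [real_inner_comm (u t) (U t), real_inner_comm (θ t) (Θ t)]
      have b1 := neg_mul_inner_le hκ R (Y t) (U t)
      have b2 := neg_mul_inner_le hν c (X t) (Θ t)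
      have k1 : R ^ 2 / (2 * κ) = 2 * (R ^ 2 / (4 * κ)) := by field_simp; norm_num
      have k2 : c ^ 2 / (2 * ν) = 2 * (c ^ 2 / (4 * ν)) := by field_simp; norm_num
      rw [k1, k2]
      have p1 : 0 ≤ R ^ 2 / (4 * κ) := by positivity
      have p2 : 0 ≤ c ^ 2 / (4 * ν) := by positivity
      have q1 : 0 ≤ α * ‖V t‖ ^ 2 := by positivity
      nlinarith [mul_nonneg p1 q1, mul_nonneg p2 q1, mul_nonneg p1 (sq_nonneg ‖Θ t‖),
        mul_nonneg p2 (sq_nonneg ‖U t‖)])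
    (by simp [hU, hV, hΘ]) (fun t => by positivity)
  have hz : ∀ t ∈ Icc 0 T, U t = 0 ∧ V t = 0 ∧ Θ t = 0 := by
    intro t ht
    have e := hE t ht
    have a1 : 0 ≤ ‖U t‖ ^ 2 := by positivity
    have a2 : 0 ≤ α * ‖V t‖ ^ 2 := by positivity
    have a3 : 0 ≤ ‖Θ t‖ ^ 2 := by positivity
    refine ⟨?_, ?_, ?_⟩
    · have : ‖U t‖ ^ 2 = 0 := by linarith
      simpa using this
    · have : α * ‖V t‖ ^ 2 = 0 := by linarith
      simpa [hα.ne'] using this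
    · have : ‖Θ t‖ ^ 2 = 0 := by linarith
      simpa using this
  intro t ht
  exact ⟨eq_zero_of_primitive_eq_zero hT hu (fun s hs => (hz s hs).1) t ht,
    eq_zero_of_primitive_eq_zero hT hθ (fun s hs => (hz s hs).2.2) t ht,
    eq_zero_of_primitive_eq_zero hT hXc (fun s hs => (hz s hs).2.1) t ht⟩

theorem MemL2H10.sub {L T : ℝ} {u ux v vx : ℝ → L2 L} (h : MemL2H10 L T u ux)
    (h' : MemL2H10 L T v vx) : MemL2H10 L T (fun t => u t - v t) (fun t => ux t - vx t) := by
  refine ⟨MemLp.sub h.1 h'.1, MemLp.sub h.2.1 h'.2.1, ?_⟩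
  filter_upwards [h.2.2, h'.2.2] with t a b
  exact (H10 L).sub_mem a b

theorem Fluid.viscosity_pos (F : Fluid) : 0 < (F.lam + 2 * F.mu) / F.rhoBar :=
  div_pos (by linarith [F.mu_pos, F.lam_add_mu_nonneg]) F.rhoBar_pos

theorem Fluid.conductivity_pos (F : Fluid) : 0 < F.kappa / (F.rhoBar * F.cv) :=
  div_pos F.kappa_pos (mul_pos F.rhoBar_pos F.cv_pos)

/-- The continuity equation expresses the density difference by the time integral of `ux - ux'`.
Substituting it into the momentum equation leaves the homogeneous system for velocity and
temperature, with `α = (R θ̄ / ρ̄) ρ̄`. -/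
theorem IsSolution.unique {F : Fluid} {L T : ℝ} (hT : 0 < T) {ρ₀ u₀ θ₀ : L2 L}
    {f g h ρ u θ ρ' u' θ' : ℝ → L2 L} (hs : IsSolution F L T ρ₀ u₀ θ₀ f g h ρ u θ)
    (hs' : IsSolution F L T ρ₀ u₀ θ₀ f g h ρ' u' θ') :
    EqOn ρ ρ' (Icc 0 T) ∧ EqOn u u' (Icc 0 T) ∧ EqOn θ θ' (Icc 0 T) := by
  obtain ⟨hρ, hu, hθ, ux, θx, hux, hθx, heq⟩ := hs
  obtain ⟨hρ', hu', hθ', ux', θx', hux', hθx', heq'⟩ := hs'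
  have hX : ∀ t ∈ Icc 0 T, ∫ s in (0 : ℝ)..t, (ux s - ux' s)
      = (∫ s in (0 : ℝ)..t, ux s) - ∫ s in (0 : ℝ)..t, ux' s := fun t ht =>
    intervalIntegral.integral_sub (hux.2.1.intervalIntegrable ht) (hux'.2.1.intervalIntegrable ht)
  have hY : ∀ t ∈ Icc 0 T, ∫ s in (0 : ℝ)..t, (θx s - θx' s)
      = (∫ s in (0 : ℝ)..t, θx s) - ∫ s in (0 : ℝ)..t, θx' s := fun t ht =>
    intervalIntegral.integral_sub (hθx.2.1.intervalIntegrable ht) (hθx'.2.1.intervalIntegrable ht)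
  have hρX : ∀ t ∈ Icc 0 T, ρ t - ρ' t = -(F.rhoBar • ∫ s in (0 : ℝ)..t, (ux s - ux' s)) := by
    intro t ht
    have e := (heq t ht).1.trans (heq' t ht).1.symm
    rw [hX t ht, smul_sub]
    rw [← sub_eq_zero] at e ⊢
    rw [← e]
    abel
  have hρi : ∀ t ∈ Icc 0 T, (∫ s in (0 : ℝ)..t, ρ s) - ∫ s in (0 : ℝ)..t, ρ' s
      = -(F.rhoBar • ∫ s in (0 : ℝ)..t, ∫ r in (0 : ℝ)..s, (ux r - ux' r)) := by
    intro t ht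
    rw [← intervalIntegral.integral_sub ((memL2L2_of_continuousOn hρ).intervalIntegrable ht)
      ((memL2L2_of_continuousOn hρ').intervalIntegrable ht), ← intervalIntegral.integral_smul,
      ← intervalIntegral.integral_neg]
    refine intervalIntegral.integral_congr fun s hs => ?_
    rw [uIcc_of_le ht.1] at hs
    exact hρX s ⟨hs.1, hs.2.trans ht.2⟩
  have hrb := F.rhoBar_pos
  have key := homogeneous_eq_zero (L := L) (T := T) (R := F.R) (α := F.R * F.thetaBar)
    (c := F.R * F.thetaBar / F.cv) hT
    F.viscosity_pos (mul_pos F.R_pos F.thetaBar_pos) F.conductivity_pos (hu.sub hu') (hθ.sub hθ')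
    (hux.sub hux') (hθx.sub hθx')
    (fun t ht φ φx hφ => by
      have e := ((heq t ht).2 φ φx hφ).1.trans ((heq' t ht).2 φ φx hφ).1.symm
      have eρ := congrArg (fun z => inner ℝ z φx) (hρi t ht)
      simp only [inner_sub_left, inner_neg_left, real_inner_smul_left] at eρ
      rw [intervalIntegral_inner (hux.2.1.intervalIntegrable ht),
        intervalIntegral_inner (hux'.2.1.intervalIntegrable ht),
        intervalIntegral_inner (hθx.2.1.intervalIntegrable ht),
        intervalIntegral_inner (hθx'.2.1.intervalIntegrable ht),
        intervalIntegral_inner ((memL2L2_of_continuousOn hρ).intervalIntegrable ht),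
        intervalIntegral_inner ((memL2L2_of_continuousOn hρ').intervalIntegrable ht)] at e
      rw [hX t ht, hY t ht]
      simp only [Pi.sub_apply, inner_sub_left]
      have ea : F.R * F.thetaBar = F.R * F.thetaBar / F.rhoBar * F.rhoBar := by field_simp
      rw [ea]
      linear_combination e + F.R * F.thetaBar / F.rhoBar * eρ)
    (fun t ht φ φx hφ => by
      have e := ((heq t ht).2 φ φx hφ).2.trans ((heq' t ht).2 φ φx hφ).2.symm
      rw [intervalIntegral_inner (hux.2.1.intervalIntegrable ht),
        intervalIntegral_inner (hux'.2.1.intervalIntegrable ht),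
        intervalIntegral_inner (hθx.2.1.intervalIntegrable ht),
        intervalIntegral_inner (hθx'.2.1.intervalIntegrable ht)] at e
      rw [hX t ht, hY t ht]
      simp only [Pi.sub_apply, inner_sub_left]
      linear_combination e)
  refine ⟨fun t ht => ?_, fun t ht => sub_eq_zero.1 (key t ht).1,
    fun t ht => sub_eq_zero.1 (key t ht).2.1⟩
  have := hρX t ht
  rwa [(key t ht).2.2, smul_zero, neg_zero, sub_eq_zero] at this

/-! ### The controlled trajectory -/

/-- The integrand vanishes at `0` and `T`, and the factor `6 / T ^ 3` gives it integral one over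
`(0,T)`. -/
theorem integral_bump (T t : ℝ) : ∫ s in (0 : ℝ)..t, 6 * s * (T - s) / T ^ 3
    = (3 * T * t ^ 2 - 2 * t ^ 3) / T ^ 3 := by
  have hd : ∀ s ∈ uIcc 0 t, HasDerivAt (fun s => (3 * T * s ^ 2 - 2 * s ^ 3) / T ^ 3)
      (6 * s * (T - s) / T ^ 3) s := fun s _ => by
    refine (((((hasDerivAt_pow 2 s).const_mul (3 * T)).sub
      ((hasDerivAt_pow 3 s).const_mul 2))).div_const (T ^ 3)).congr_deriv ?_
    norm_num
    ring
  rw [intervalIntegral.integral_eq_sub_of_hasDerivAt hd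
    (by apply Continuous.intervalIntegrable; fun_prop)]
  simp

theorem integral_bump_deriv (T t : ℝ) : ∫ s in (0 : ℝ)..t, 6 * (T - 2 * s) / T ^ 3
    = 6 * t * (T - t) / T ^ 3 := by
  have hd : ∀ s ∈ uIcc 0 t, HasDerivAt (fun s => 6 * s * (T - s) / T ^ 3)
      (6 * (T - 2 * s) / T ^ 3) s := fun s _ => by
    refine ((((hasDerivAt_id s).const_mul 6).mul
      ((hasDerivAt_id s).const_sub T)).div_const (T ^ 3)).congr_deriv ?_
    simp only [id]
    ring
  rw [intervalIntegral.integral_eq_sub_of_hasDerivAt hd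
    (by apply Continuous.intervalIntegrable; fun_prop)]
  simp

set_option maxHeartbeats 800000 in
/-- Controls that steer the system to rest: the heat flow damped to zero for `θ`, and for `u` the
same plus a multiple of an element of `H¹₀` chosen so that the density vanishes at time `T`. -/
theorem exists_controlled_solution (F : Fluid) {L : ℝ} (hL : 0 < L) {ρ₀ : L2 L} (u₀ θ₀ : L2 L)
    (hρ₀ : ρ₀ ∈ H1m L) {T : ℝ} (hT : 0 < T) :
    ∃ g h : ℝ → L2 L, MemL2L2 L T g ∧ MemL2L2 L T h ∧ ∃ ρ u θ : ℝ → L2 L,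
      IsSolution F L T ρ₀ u₀ θ₀ (fun _ => 0) g h ρ u θ ∧ ρ T = 0 ∧ u T = 0 ∧ θ T = 0 := by
  obtain ⟨⟨ρ₁, hρ₁⟩, hmean⟩ := hρ₀
  have hν := F.viscosity_pos
  set ν := (F.lam + 2 * F.mu) / F.rhoBar with hνdef
  set a := F.R * F.thetaBar / F.rhoBar with hadef
  set c := F.R * F.thetaBar / F.cv with hcdef
  obtain ⟨b, hbdef⟩ : ∃ b, b = F.rhoBar := ⟨_, rfl⟩
  have hb : b ≠ 0 := hbdef ▸ F.rhoBar_pos.ne'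
  obtain ⟨w, wx, G, hw, hG, hw0, hwT, hwx, hweq⟩ := exists_heat_flow_to_zero hL hν hT u₀
  obtain ⟨θ, θx, H, hθ, hH, hθ0, hθT, hθx, hθeq⟩ :=
    exists_heat_flow_to_zero hL F.conductivity_pos hT θ₀
  have hTm : T ∈ Icc 0 T := ⟨hT.le, le_rfl⟩
  have hGi : ∀ t ∈ Icc 0 T, IntervalIntegrable G volume 0 t := fun t ht =>
    (memL2L2_of_continuousOn hG).intervalIntegrable ht
  let η : ℝ → ℝ := fun s => 6 * s * (T - s) / T ^ 3
  let η' : ℝ → ℝ := fun s => 6 * (T - 2 * s) / T ^ 3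
  let J : ℝ → ℝ := fun t => (3 * T * t ^ 2 - 2 * t ^ 3) / T ^ 3
  have hη : Continuous η := by fun_prop
  have hη' : Continuous η' := by fun_prop
  have hJ : Continuous J := by fun_prop
  let X : ℝ → L2 L := fun t => ∫ s in (0 : ℝ)..t, wx s
  let K : ℝ → L2 L := fun t => ∫ s in (0 : ℝ)..t, G s
  have hX : ContinuousOn X (Icc 0 T) := hwx.2.1.continuousOn_primitive hT.le
  have hK : ContinuousOn K (Icc 0 T) :=
    (memL2L2_of_continuousOn hG).continuousOn_primitive hT.le
  -- the weak second derivative of the time primitive of `w`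
  have hXφ : ∀ t ∈ Icc 0 T, ∀ φ φx, (φ, φx) ∈ H10 L →
      inner ℝ (X t) φx = -inner ℝ (ν⁻¹ • (w t - u₀ - K t)) φ := by
    intro t ht φ φx hφ
    have e := hweq t ht φ φx hφ
    rw [intervalIntegral_inner (hwx.2.1.intervalIntegrable ht),
      intervalIntegral_inner (hGi t ht)] at e
    change _ + ν * inner ℝ (X t) φx = inner ℝ (K t) φ at e
    simp only [real_inner_smul_left, inner_sub_left]
    field_simp
    linear_combination e
  -- the correction that steers the density to zero
  let Q : L2 L := b⁻¹ • primitive hL ρ₀ - ∫ s in (0 : ℝ)..T, w s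
  let q : L2 L := b⁻¹ • ρ₀ - X T
  have hQ : (Q, q) ∈ H10 L :=
    (H10 L).sub_mem ((H10 L).smul_mem b⁻¹ (primitive_mem_H10 hL ρ₀ hmean)) (hwx.integral_mem hTm)
  -- The weak derivative of `q`: since `w T = 0`, that of `X T` is `-ν⁻¹ (u₀ + K T)`.
  let q' : L2 L := b⁻¹ • ρ₁ + ν⁻¹ • (u₀ + K T)
  have hqφ : ∀ φ φx, (φ, φx) ∈ H10 L → inner ℝ q φx = -inner ℝ q' φ := by
    intro φ φx hφ
    have e1 := hρ₁.inner_eq hφ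
    have e2 := hXφ T hTm φ φx hφ
    rw [hwT] at e2
    simp only [q, q', inner_sub_left, inner_add_left, real_inner_smul_left, inner_zero_left]
      at e2 ⊢
    rw [e1, e2]
    ring
  -- The bump leaves the values at `0` and `T` unchanged, while the integral of `ux` over `(0,T)`
  -- becomes `X T + q = b⁻¹ ρ₀`.
  let u : ℝ → L2 L := fun t => w t + η t • Q
  let ux : ℝ → L2 L := fun t => wx t + η t • q
  have hu : ContinuousOn u (Icc 0 T) := by fun_prop
  have hηq : ContinuousOn (fun t => η t • q) (Icc 0 T) := by fun_prop
  have hux : MemL2H10 L T u ux := by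
    refine ⟨memL2L2_of_continuousOn hu, MemLp.add hwx.2.1 (memL2L2_of_continuousOn hηq), ?_⟩
    filter_upwards [hwx.2.2] with t ht
    exact (H10 L).add_mem ht ((H10 L).smul_mem (η t) hQ)
  have huxi : ∀ t ∈ Icc 0 T, ∫ s in (0 : ℝ)..t, ux s = X t + J t • q := by
    intro t ht
    rw [intervalIntegral.integral_add (hwx.2.1.intervalIntegrable ht)
      ((memL2L2_of_continuousOn hηq).intervalIntegrable ht),
      intervalIntegral.integral_smul_const, integral_bump]
  let ρ : ℝ → L2 L := fun t => ρ₀ - b • (X t + J t • q)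
  have hρ : ContinuousOn ρ (Icc 0 T) := by fun_prop
  -- The weak space derivative of `ρ t`. It is continuous in time with values in `L²`, so the
  -- control can cancel the pressure term.
  let r : ℝ → L2 L := fun t => ρ₁ - b • (ν⁻¹ • (w t - u₀ - K t) + J t • q')
  have hr : ContinuousOn r (Icc 0 T) := by fun_prop
  have hri : ∀ t ∈ Icc 0 T, IntervalIntegrable r volume 0 t := fun t ht =>
    (memL2L2_of_continuousOn hr).intervalIntegrable ht
  have har : ∀ t ∈ Icc 0 T, IntervalIntegrable (fun s => a • r s) volume 0 t := fun t ht =>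
    (hri t ht).smul a
  have hρφ : ∀ t ∈ Icc 0 T, ∀ φ φx, (φ, φx) ∈ H10 L →
      inner ℝ (ρ t) φx = -inner ℝ (r t) φ := by
    intro t ht φ φx hφ
    have e1 := hρ₁.inner_eq hφ
    have e2 := hXφ t ht φ φx hφ
    have e3 := hqφ φ φx hφ
    simp only [ρ, r]
    rw [inner_sub_left, inner_sub_left, real_inner_smul_left, real_inner_smul_left,
      inner_add_left, inner_add_left, real_inner_smul_left _ _ (J t),
      real_inner_smul_left _ _ (J t), e1, e2, e3]
    ring
  have hc1 : ContinuousOn (fun t => η' t • Q - (ν * η t) • q') (Icc 0 T) := by fun_prop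
  have hc2 : ContinuousOn (fun t => G t + (η' t • Q - (ν * η t) • q') + a • r t) (Icc 0 T) := by
    fun_prop
  have hc2m := memL2L2_of_continuousOn hc2
  have hRθ : MemL2L2 L T (fun t => F.R • θx t) := MemLp.const_smul hθx.2.1 F.R
  have hcu : MemL2L2 L T (fun t => c • ux t) := MemLp.const_smul hux.2.1 c
  have hHm := memL2L2_of_continuousOn hH
  -- The controls are the left-hand sides of the equations: `G` and `H` come from the damped heat
  -- flows, the bracket is the heat operator applied to `η Q`, and the remaining terms are the
  -- couplings.
  refine ⟨fun t => G t + (η' t • Q - (ν * η t) • q') + a • r t + F.R • θx t,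
    fun t => H t + c • ux t, MemLp.add hc2m hRθ, MemLp.add hHm hcu, ρ, u, θ,
    ⟨hρ, hu, hθ, ux, θx, hux, hθx, fun t ht => ⟨?_, fun φ φx hφ => ⟨?_, ?_⟩⟩⟩, ?_, ?_, hθT⟩
  · rw [huxi t ht]
    simp [ρ, hbdef]
  · rw [← hνdef, ← hadef, intervalIntegral_inner (hux.2.1.intervalIntegrable ht), huxi t ht,
      intervalIntegral_inner (hθx.2.1.intervalIntegrable ht),
      intervalIntegral_inner ((hc2m.intervalIntegrable ht).add (hRθ.intervalIntegrable ht)),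
      intervalIntegral.integral_add (hc2m.intervalIntegrable ht) (hRθ.intervalIntegrable ht),
      intervalIntegral.integral_add
        ((hGi t ht).add ((memL2L2_of_continuousOn hc1).intervalIntegrable ht))
        (har t ht),
      intervalIntegral.integral_add (hGi t ht)
        ((memL2L2_of_continuousOn hc1).intervalIntegrable ht),
      intervalIntegral.integral_sub (by apply Continuous.intervalIntegrable; fun_prop)
        (by apply Continuous.intervalIntegrable; fun_prop),
      intervalIntegral.integral_smul_const, intervalIntegral.integral_smul_const,
      intervalIntegral.integral_smul, intervalIntegral.integral_smul,
      intervalIntegral.integral_const_mul, integral_bump, integral_bump_deriv]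
    have e4 : ∫ s in (0 : ℝ)..t, inner ℝ (ρ s) φx = -inner ℝ (∫ s in (0 : ℝ)..t, r s) φ := by
      rw [← intervalIntegral_inner (hri t ht), ← intervalIntegral.integral_neg]
      refine intervalIntegral.integral_congr fun s hs => ?_
      rw [uIcc_of_le ht.1] at hs
      exact hρφ s ⟨hs.1, hs.2.trans ht.2⟩ φ φx hφ
    have e2 := hXφ t ht φ φx hφ
    have e3 := hqφ φ φx hφ
    have hνν : ν * ν⁻¹ = 1 := mul_inv_cancel₀ hν.ne'
    rw [e4]
    simp only [u, η, inner_add_left, inner_sub_left, real_inner_smul_left] at e2 ⊢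
    rw [e2, e3]
    simp only [J, K]
    linear_combination -(inner ℝ (w t) φ - inner ℝ u₀ φ - inner ℝ (∫ s in (0 : ℝ)..t, G s) φ) * hνν
  · rw [intervalIntegral_inner ((hHm.intervalIntegrable ht).add (hcu.intervalIntegrable ht)),
      intervalIntegral.integral_add (hHm.intervalIntegrable ht) (hcu.intervalIntegrable ht),
      intervalIntegral.integral_smul, inner_add_left, real_inner_smul_left,
      ← intervalIntegral_inner (hHm.intervalIntegrable ht), ← hθeq t ht φ φx hφ,
      intervalIntegral_inner (hux.2.1.intervalIntegrable ht)]
  · have hJT : J T = 1 := by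
      simp only [J]
      field_simp
      norm_num
    simp only [ρ, q, hJT, one_smul]
    rw [add_sub_cancel, smul_smul, mul_inv_cancel₀ hb, one_smul, sub_self]
  · simp [u, η, hwT]

end LinNS

/-! ### Null controllability -/

theorem mainTheorem2 (F : LinNS.Fluid) (L : ℝ) (hL : 0 < L)
    (ρ₀ u₀ θ₀ : LinNS.L2 L) (hρ₀ : ρ₀ ∈ LinNS.H1m L) (T : ℝ) (hT : 0 < T) :
    ∃ g h : ℝ → LinNS.L2 L, LinNS.MemL2L2 L T g ∧ LinNS.MemL2L2 L T h ∧
      ∃ ρ u θ : ℝ → LinNS.L2 L,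
        LinNS.IsSolution F L T ρ₀ u₀ θ₀ (fun _ => 0) g h ρ u θ ∧
        (∀ ρ' u' θ' : ℝ → LinNS.L2 L,
          LinNS.IsSolution F L T ρ₀ u₀ θ₀ (fun _ => 0) g h ρ' u' θ' →
            Set.EqOn ρ' ρ (Set.Icc 0 T) ∧ Set.EqOn u' u (Set.Icc 0 T) ∧
              Set.EqOn θ' θ (Set.Icc 0 T)) ∧
        ρ T = 0 ∧ u T = 0 ∧ θ T = 0 := by
  obtain ⟨g, h, hg, hh, ρ, u, θ, hs, hend⟩ :=
    LinNS.exists_controlled_solution F hL u₀ θ₀ hρ₀ hT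
  exact ⟨g, h, hg, hh, ρ, u, θ, hs, fun ρ' u' θ' hs' => hs'.unique hT hs, hend⟩
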